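/- Let $(X,\mu)$ be a $\sigma$-finite measure space, $\mathcal B$ a complex Banach space, $1<p<\infty$, and let $\mathcal T=\{T_t:t\ge 0\}$ be a strongly continuous semigroup of bounded operators on the complex space $L^2(X)$ with the contraction property, i.e. $\|T_tf\|_q\le\|f\|_q$ for all $f\in L^2(X)\cap L^q(X)$, all $t\ge0$ and all $q\in[1,\infty]$. Write $L^p(X,\mathcal B)$ for the Bochner space; a bounded operator $\tilde S$ on $L^p(X,\mathcal B)$ is called a tensor product extension of an operator $S$ on $L^p(X)$ if $\tilde S\big(\sum_{k=1}^n u_kf_k\big)=\sum_{k=1}^n u_k\,Sf_k$ for all $n$, $u_k\in\mathcal B$ and $f_k\in L^p(X)$. Then each $T_t$ extends uniquely from $L^2(X)\cap L^p(X)$ to a bounded operator on $L^p(X)$, again denoted by $T_t$, and these extensions form a strongly continuous semigroup on $L^p(X)$. Each $T_t$ ($t\ge 0$), and each ergodic average $$A(\mathcal T,t)f=\frac1t\int_0^tT_sf\,ds\qquad(f\in L^p(X),\ t>0),$$ has a unique tensor product extension, $\tilde T_t$ and $\tilde A(\mathcal T,t)$ respectively, to $L^p(X,\mathcal B)$; the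 operators $\tilde T_t$ form a strongly continuous semigroup, and $\tilde A(\mathcal T,t)F=\frac1t\int_0^t\tilde T_sF\,ds$ for all $F\in L^p(X,\mathcal B)$ and $t>0$. For every $F\in L^p(X,\mathcal B)$ the maximal ergodic function $$\mathcal A^{\mathcal T}_{\mathcal B}F=\sup_{t>0}\big|\tilde A(\mathcal T,t)F\big|_{\mathcal B},$$ where the supremum is that of classes of measurable functions modulo null sets (the almost everywhere least measurable function that dominates each member of the family almost everywhere), exists, coincides almost everywhere with the pointwise supremum over the positive rational $t$, and satisfies $$\big\|\mathcal A^{\mathcal T}_{\mathcal B}F\big\|_{L^p(X)}\le 2\Big(\frac p{p-1}\Big)^{1/p}\|F\|_{L^p(X,\mathcal B)}.$$ -/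

import Mathlib

open MeasureTheory
open scoped NNReal ENNReal

noncomputable section

/-- `T` is a strongly continuous one-parameter semigroup of bounded operators on `E`,
with time set `[0, ∞)`. -/
structure IsStronglyContinuousSemigroup {E : Type*} [NormedAddCommGroup E] [NormedSpace ℂ E]
    (T : ℝ≥0 → E →L[ℂ] E) : Prop where
  zero : T 0 = ContinuousLinearMap.id ℂ E
  add : ∀ s t : ℝ≥0, T (s + t) = (T s).comp (T t)
  continuous : ∀ f : E, Continuous fun t : ℝ≥0 => T t f

/-- The contraction property: `‖T_t f‖_q ≤ ‖f‖_q` for all `f ∈ L² ∩ L^q`, all `t ≥ 0` and all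
`q ∈ [1, ∞]`. -/
def ContractionProperty {X : Type*} [MeasurableSpace X] {μ : Measure X}
    (T : ℝ≥0 → Lp ℂ 2 μ →L[ℂ] Lp ℂ 2 μ) : Prop :=
  ∀ (t : ℝ≥0) (q : ℝ≥0∞), 1 ≤ q → ∀ f : Lp ℂ 2 μ, MemLp f q μ →
    eLpNorm (T t f) q μ ≤ eLpNorm f q μ

/-- The bounded operator `S` on `L^p(X)` extends the operator `T` on `L²(X)`: the two agree on
`L²(X) ∩ L^p(X)`. -/
def IsLpExtension {X : Type*} [MeasurableSpace X] {μ : Measure X} {p : ℝ≥0∞} [Fact (1 ≤ p)]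
    (T : Lp ℂ 2 μ →L[ℂ] Lp ℂ 2 μ) (S : Lp ℂ p μ →L[ℂ] Lp ℂ p μ) : Prop :=
  ∀ (f : Lp ℂ 2 μ) (g : Lp ℂ p μ), f =ᵐ[μ] g → T f =ᵐ[μ] S g

/-- The function `x ↦ f(x) u` in `L^p(X, B)`, for `f ∈ L^p(X)` and `u ∈ B`. -/
def lpTensor {X : Type*} [MeasurableSpace X] {μ : Measure X} {p : ℝ≥0∞}
    {B : Type*} [NormedAddCommGroup B] [NormedSpace ℂ B]
    (f : Lp ℂ p μ) (u : B) : Lp B p μ :=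
  (ContinuousLinearMap.toSpanSingleton ℂ u).compLp f

/-- The bounded operator `R` on `L^p(X, B)` is a tensor product extension of the operator `S` on
`L^p(X)`: it agrees with `S ⊗ I_B` on all finite sums `∑ u_k f_k`. -/
def IsTensorExtension {X : Type*} [MeasurableSpace X] {μ : Measure X} {p : ℝ≥0∞} [Fact (1 ≤ p)]
    {B : Type*} [NormedAddCommGroup B] [NormedSpace ℂ B]
    (S : Lp ℂ p μ → Lp ℂ p μ) (R : Lp B p μ →L[ℂ] Lp B p μ) : Prop :=
  ∀ (n : ℕ) (u : Fin n → B) (f : Fin n → Lp ℂ p μ),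
    R (∑ k, lpTensor (f k) (u k)) = ∑ k, lpTensor (S (f k)) (u k)

/-- The ergodic average `(1/t) ∫_0^t T_s f ds`, a Bochner integral in `E`. -/
def ergodicAverage {E : Type*} [NormedAddCommGroup E] [NormedSpace ℂ E]
    (T : ℝ≥0 → E →L[ℂ] E) (t : ℝ≥0) (f : E) : E :=
  (t : ℝ)⁻¹ • ∫ s in (0 : ℝ)..t, T s.toNNReal f

/-- `M` is the supremum of the family `u` of `[0, ∞]`-valued functions in the sense of classes
of functions modulo null sets: `M` is measurable, dominates every member of the family almost
everywhere, and is almost everywhere the least such function. -/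
structure IsAESup {X : Type*} [MeasurableSpace X] (μ : Measure X) {ι : Type*}
    (u : ι → X → ℝ≥0∞) (M : X → ℝ≥0∞) : Prop where
  aemeasurable : AEMeasurable M μ
  le : ∀ i, u i ≤ᵐ[μ] M
  least : ∀ N : X → ℝ≥0∞, AEMeasurable N μ → (∀ i, u i ≤ᵐ[μ] N) → M ≤ᵐ[μ] N

end

open Filter Topology InnerProductSpace

/-! The inequality is reduced to positive matrices, where Hopf's argument is elementary. Compress a
contraction `S` of `L²` to the span of the indicators of finitely many disjoint cells. Contractivity
on `L^∞` and on `L¹` says that the matrix of the compression has absolute row sums at most 1 and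
weighted absolute column sums at most the weights. The matrix of absolute values is therefore
sub-Markov, and it dominates the norms of the orbit of any vector with entries in `B`. So no
positivity of `S` and no geometry of `B` is needed.

For a sub-Markov matrix, Hopf's lemma applied to `f - 2r` gives a weak type bound
(`IsSubMarkov.weak_type`) whose right side sees only `{f > r}`. Integrating it against `r^(p-2)`
gives the factor `2^p p/(p-1)`, whose `p`-th root is the stated constant. Refining the cells makes
the powers of the compression converge to those of `S` on given vectors, and Fatou's lemma transfers
the bound to `S` on tensors of simple functions (`lintegral_sup_average_simpleFunc_le`).

This bound also yields the tensor extension: applied to the average of `F` and `SF`, it bounds `SF`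
by `F` (`norm_tensorSum_le`), uniformly in the time. For finitely many rational times, the ergodic
averages are limits of discrete averages of a single operator `T_δ`, with `δ` running through
reciprocals of multiples of a common denominator (`eLpNorm_sup_ergodicAverage_le`). Monotone
convergence reaches all positive rationals, and continuity of the averages in time identifies the
rational supremum with the supremum of classes. -/

/-! ### Hopf's maximal lemma and the weak type inequality on finite spaces -/

/-- A positive linear operator on a finite weighted space that contracts both `ℓ^∞` and the
weighted `ℓ¹`. -/
structure IsSubMarkov {ι : Type*} [Fintype ι] (m : ι → ℝ) (P : Module.End ℝ (ι → ℝ)) : Prop where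
  nonneg : ∀ f, 0 ≤ f → 0 ≤ P f
  one_le : P 1 ≤ 1
  sum_le : ∀ f, 0 ≤ f → ∑ i, m i * P f i ≤ ∑ i, m i * f i

/-- Recursive majorant of the partial sums `∑ k < n, P^k h` and of `0`. -/
def hopfMax {ι : Type*} (P : Module.End ℝ (ι → ℝ)) (h : ι → ℝ) : ℕ → ι → ℝ
  | 0 => 0
  | n + 1 => (h + P (hopfMax P h n)) ⊔ 0

theorem hopfMax_nonneg {ι : Type*} (P : Module.End ℝ (ι → ℝ)) (h : ι → ℝ) (n : ℕ) :
    0 ≤ hopfMax P h n := by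
  cases n with
  | zero => exact le_rfl
  | succ n => exact le_sup_right

namespace IsSubMarkov

variable {ι : Type*} [Fintype ι] {m : ι → ℝ} {P : Module.End ℝ (ι → ℝ)}

theorem monotone (hP : IsSubMarkov m P) {f g : ι → ℝ} (h : f ≤ g) : P f ≤ P g := by
  have := hP.nonneg (g - f) (sub_nonneg.2 h)
  rwa [map_sub, sub_nonneg] at this

theorem hopfMax_le_succ (hP : IsSubMarkov m P) (h : ι → ℝ) (n : ℕ) :
    hopfMax P h n ≤ hopfMax P h (n + 1) := by
  induction n with
  | zero => exact hopfMax_nonneg P h 1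
  | succ n ih => exact sup_le_sup_right (add_le_add_right (hP.monotone ih) h) 0

/-- A partial sum of length `n + 1` is `h` plus `P` of the one of length `n`, which is the recursion
of `hopfMax` without the truncation at 0. -/
theorem sum_pow_le_hopfMax (hP : IsSubMarkov m P) (h : ι → ℝ) (n : ℕ) :
    ∑ k ∈ Finset.range n, (P ^ k) h ≤ hopfMax P h n := by
  induction n with
  | zero => simp [hopfMax]
  | succ n ih =>
    rw [Finset.sum_range_succ']
    have : ∑ k ∈ Finset.range n, (P ^ (k + 1)) h = P (∑ k ∈ Finset.range n, (P ^ k) h) := by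
      rw [map_sum]
      exact Finset.sum_congr rfl fun k _ => by rw [pow_succ']; rfl
    rw [this, pow_zero, add_comm]
    exact (add_le_add_right (hP.monotone ih) h).trans le_sup_left

/-- Hopf's maximal lemma on a finite weighted space. -/
theorem sum_hopfMax_pos_nonneg (hP : IsSubMarkov m P) (hm : ∀ i, 0 ≤ m i) (h : ι → ℝ) (n : ℕ) :
    0 ≤ ∑ i with 0 < hopfMax P h n i, m i * h i := by
  classical
  cases n with
  | zero => simp [hopfMax]
  | succ n =>
    set M := hopfMax P h (n + 1) with hM
    have hM0 : 0 ≤ M := hopfMax_nonneg P h _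
    -- Where `M > 0` the truncation is inactive, so `M ≤ h + P M` there. Elsewhere `M = 0` and `M -
    -- P M ≤ 0`, while the total weighted sum of `M - P M` is nonnegative by the `ℓ¹` contraction.
    have h1 : ∀ i, 0 < M i → m i * M i - m i * P M i ≤ m i * h i := by
      intro i hi
      have h2 : M i = h i + P (hopfMax P h n) i := by
        have h3 : M i = max (h i + P (hopfMax P h n) i) 0 := rfl
        rw [h3] at hi ⊢
        exact max_eq_left (by by_contra hc; simp [max_eq_right (not_le.1 hc).le] at hi)
      have h4 : P (hopfMax P h n) i ≤ P M i := hP.monotone (hP.hopfMax_le_succ h n) i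
      rw [← mul_sub]
      exact mul_le_mul_of_nonneg_left (by linarith) (hm i)
    calc (0 : ℝ) ≤ ∑ i, (m i * M i - m i * P M i) := by
          rw [Finset.sum_sub_distrib]
          linarith [hP.sum_le M hM0]
      _ ≤ ∑ i with 0 < M i, (m i * M i - m i * P M i) := by
          rw [Finset.sum_filter]
          refine Finset.sum_le_sum fun i _ => ?_
          split_ifs with hi
          · exact le_rfl
          · have : M i = 0 := le_antisymm (not_lt.1 hi) (hM0 i)
            rw [this]
            have := mul_nonneg (hm i) (hP.nonneg M hM0 i)
            simp only [mul_zero, zero_sub]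
            linarith
      _ ≤ ∑ i with 0 < M i, m i * h i :=
          Finset.sum_le_sum fun i hi => h1 i (Finset.mem_filter.1 hi).2

theorem pow_one_le (hP : IsSubMarkov m P) (k : ℕ) : (P ^ k) 1 ≤ 1 := by
  induction k with
  | zero => exact le_rfl
  | succ k ih =>
    rw [pow_succ']
    exact (hP.monotone ih).trans hP.one_le

/-- Weak type maximal inequality on a finite weighted space. -/
theorem weak_type (hP : IsSubMarkov m P) (hm : ∀ i, 0 ≤ m i) (f : ι → ℝ)
    (ν : ι → ℕ) {r : ℝ} (hr : 0 < r) :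
    r * ∑ i with 2 * r < ((ν i : ℝ) + 1)⁻¹ * ∑ k ∈ Finset.range (ν i + 1), (P ^ k) f i, m i ≤
      ∑ i with r < f i, m i * f i := by
  classical
  -- One level `N` serves all the stopping indices `ν i`, since `hopfMax` increases with the level.
  set N := Finset.univ.sup ν + 1 with hN
  set h : ι → ℝ := f - (2 * r) • (1 : ι → ℝ) with hh
  have hmono : Monotone (hopfMax P h) := monotone_nat_of_le_succ (hP.hopfMax_le_succ h)
  have hsub : ∀ i, 2 * r < ((ν i : ℝ) + 1)⁻¹ * ∑ k ∈ Finset.range (ν i + 1), (P ^ k) f i →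
      0 < hopfMax P h N i := by
    intro i hi
    have hle : ν i + 1 ≤ N := by
      have : ν i ≤ Finset.univ.sup ν := Finset.le_sup (Finset.mem_univ i)
      omega
    have h1 := (hP.sum_pow_le_hopfMax h (ν i + 1)) i
    refine lt_of_lt_of_le ?_ (h1.trans (hmono hle i))
    have hpos : (0 : ℝ) < (ν i : ℝ) + 1 := by positivity
    rw [inv_mul_eq_div, lt_div_iff₀ hpos] at hi
    rw [Finset.sum_apply]
    have h2 : ∀ k ∈ Finset.range (ν i + 1), (P ^ k) f i - 2 * r ≤ (P ^ k) h i := by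
      intro k _
      have h3 : (P ^ k) h i = (P ^ k) f i - 2 * r * (P ^ k) 1 i := by
        rw [hh, map_sub, map_smul]; rfl
      have h4 : (P ^ k) 1 i ≤ 1 := hP.pow_one_le k i
      rw [h3]
      nlinarith
    refine lt_of_lt_of_le ?_ (Finset.sum_le_sum h2)
    rw [Finset.sum_sub_distrib, Finset.sum_const, Finset.card_range, nsmul_eq_mul]
    push_cast
    linarith
  have hopf := hP.sum_hopfMax_pos_nonneg hm h N
  calc _ ≤ r * ∑ i with 0 < hopfMax P h N i, m i := by
        refine mul_le_mul_of_nonneg_left ?_ hr.le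
        refine Finset.sum_le_sum_of_subset_of_nonneg ?_ fun i _ _ => hm i
        intro i hi
        simp only [Finset.mem_filter, Finset.mem_univ, true_and] at hi ⊢
        exact hsub i hi
    -- Hopf's lemma says that `f - 2r` has nonnegative weighted sum over this set; one of the two
    -- copies of `r` is moved to the left.
    _ ≤ ∑ i with 0 < hopfMax P h N i, m i * (f i - r) := by
        rw [Finset.mul_sum, ← sub_nonneg, ← Finset.sum_sub_distrib]
        convert hopf using 2 with i
        simp only [hh, Pi.sub_apply, Pi.smul_apply, Pi.one_apply, smul_eq_mul]
        ring
    -- The remaining `-r` discards the points with `f ≤ r`.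
    _ ≤ ∑ i with r < f i, m i * f i := by
        rw [Finset.sum_filter, Finset.sum_filter]
        refine Finset.sum_le_sum fun i _ => ?_
        have := hm i
        split_ifs with h1 h2 h2
        · nlinarith
        · nlinarith
        · nlinarith
        · exact le_rfl

end IsSubMarkov

/-! ### From weak type to strong type -/

theorem lintegral_Ioo_rpow {r c : ℝ} (hr : -1 < r) (hc : 0 ≤ c) :
    ∫⁻ x in Set.Ioo 0 c, ENNReal.ofReal (x ^ r) = ENNReal.ofReal (c ^ (r + 1) / (r + 1)) := by
  have hint : IntegrableOn (fun x : ℝ => x ^ r) (Set.Ioc 0 c) :=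
    (intervalIntegrable_iff_integrableOn_Ioc_of_le hc).1
      (intervalIntegral.intervalIntegrable_rpow' hr)
  rw [Measure.restrict_congr_set Ioo_ae_eq_Ioc, ← ofReal_integral_eq_lintegral_ofReal hint,
    ← intervalIntegral.integral_of_le hc, integral_rpow (Or.inl hr),
    Real.zero_rpow (by linarith), sub_zero]
  filter_upwards [ae_restrict_mem measurableSet_Ioc] with x hx
  exact Real.rpow_nonneg hx.1.le r

/-- Passage from the weak type inequality to the strong one on a finite weighted space. -/
theorem sum_rpow_le_of_weak_type {ι : Type*} [Fintype ι] {m : ι → ℝ} (hm : ∀ i, 0 ≤ m i)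
    {f y : ι → ℝ} (hf : ∀ i, 0 ≤ f i) (hy : ∀ i, 0 ≤ y i) {p : ℝ} (hp : 1 < p)
    (h : ∀ r > 0, r * ∑ i with 2 * r < y i, m i ≤ ∑ i with r < f i, m i * f i) :
    ∑ i, m i * y i ^ p ≤ 2 ^ p * (p / (p - 1)) * ∑ i, m i * f i ^ p := by
  classical
  have hp0 : 0 < p := by linarith
  have hp1 : 0 < p - 1 := by linarith
  -- Multiply the weak type inequality by `r^(p-2)` and integrate over `r > 0`. On the left `r`
  -- ranges over `(0, y/2)` with density `r^(p-1)`, on the right over `(0, f)` with density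
  -- `r^(p-2)`, integrable at 0 because `p > 1`.
  have key : ∑ i, m i * ((y i / 2) ^ p / p) ≤ ∑ i, m i * f i * (f i ^ (p - 1) / (p - 1)) := by
    have e1 : ENNReal.ofReal (∑ i, m i * ((y i / 2) ^ p / p)) =
        ∫⁻ r in Set.Ioi (0 : ℝ), ∑ i, ENNReal.ofReal (m i) *
          (Set.Ioo 0 (y i / 2)).indicator (fun r => ENNReal.ofReal (r ^ (p - 1))) r := by
      rw [lintegral_finsetSum' _ (fun i _ => by
        refine (Measurable.const_mul (Measurable.indicator ?_ measurableSet_Ioo) _).aemeasurable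
        fun_prop), ENNReal.ofReal_sum_of_nonneg (fun i _ => by
          have := hm i; have := hy i; positivity)]
      refine Finset.sum_congr rfl fun i _ => ?_
      rw [lintegral_const_mul' _ _ ENNReal.ofReal_ne_top, lintegral_indicator measurableSet_Ioo,
        Measure.restrict_restrict measurableSet_Ioo,
        Set.inter_eq_left.2 Set.Ioo_subset_Ioi_self,
        lintegral_Ioo_rpow (by linarith) (by have := hy i; positivity),
        ENNReal.ofReal_mul (hm i), sub_add_cancel]
    have e2 : ENNReal.ofReal (∑ i, m i * f i * (f i ^ (p - 1) / (p - 1))) =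
        ∫⁻ r in Set.Ioi (0 : ℝ), ∑ i, ENNReal.ofReal (m i * f i) *
          (Set.Ioo 0 (f i)).indicator (fun r => ENNReal.ofReal (r ^ (p - 2))) r := by
      rw [lintegral_finsetSum' _ (fun i _ => by
        refine (Measurable.const_mul (Measurable.indicator ?_ measurableSet_Ioo) _).aemeasurable
        fun_prop), ENNReal.ofReal_sum_of_nonneg (fun i _ => by
          have := hm i; have := hf i; positivity)]
      refine Finset.sum_congr rfl fun i _ => ?_
      rw [lintegral_const_mul' _ _ ENNReal.ofReal_ne_top, lintegral_indicator measurableSet_Ioo,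
        Measure.restrict_restrict measurableSet_Ioo,
        Set.inter_eq_left.2 Set.Ioo_subset_Ioi_self,
        lintegral_Ioo_rpow (by linarith) (hf i),
        ENNReal.ofReal_mul (mul_nonneg (hm i) (hf i)), show p - 2 + 1 = p - 1 by ring]
    rw [← ENNReal.ofReal_le_ofReal_iff (Finset.sum_nonneg fun i _ => by
      have := hm i; have := hf i; positivity), e1, e2]
    refine setLIntegral_mono' measurableSet_Ioi fun r hr => ?_
    have hr0 : (0 : ℝ) < r := hr
    have c1 : ∀ i, ENNReal.ofReal (m i) *
        (Set.Ioo 0 (y i / 2)).indicator (fun r => ENNReal.ofReal (r ^ (p - 1))) r =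
        ENNReal.ofReal (if 2 * r < y i then m i * r ^ (p - 1) else 0) := by
      intro i
      by_cases hi : 2 * r < y i
      · rw [Set.indicator_of_mem (show r ∈ Set.Ioo 0 (y i / 2) from ⟨hr0, by linarith⟩),
          if_pos hi, ENNReal.ofReal_mul (hm i)]
      · rw [Set.indicator_of_notMem (fun h => hi (by linarith [h.2])), if_neg hi]; simp
    have c2 : ∀ i, ENNReal.ofReal (m i * f i) *
        (Set.Ioo 0 (f i)).indicator (fun r => ENNReal.ofReal (r ^ (p - 2))) r =
        ENNReal.ofReal (if r < f i then m i * f i * r ^ (p - 2) else 0) := by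
      intro i
      by_cases hi : r < f i
      · rw [Set.indicator_of_mem (show r ∈ Set.Ioo 0 (f i) from ⟨hr0, hi⟩), if_pos hi,
          ENNReal.ofReal_mul (mul_nonneg (hm i) (hf i))]
      · rw [Set.indicator_of_notMem (fun h => hi h.2), if_neg hi]; simp
    simp_rw [c1, c2]
    rw [← ENNReal.ofReal_sum_of_nonneg, ← ENNReal.ofReal_sum_of_nonneg]
    · refine ENNReal.ofReal_le_ofReal ?_
      rw [← Finset.sum_filter, ← Finset.sum_filter, ← Finset.sum_mul, ← Finset.sum_mul]
      have hrp : r ^ (p - 1) = r * r ^ (p - 2) := by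
        rw [show p - 1 = 1 + (p - 2) by ring, Real.rpow_add hr0, Real.rpow_one]
      rw [hrp, ← mul_assoc, mul_comm _ r]
      exact mul_le_mul_of_nonneg_right (h r hr0) (by positivity)
    · intro i _; split_ifs
      · have := hm i; have := hf i; positivity
      · exact le_rfl
    · intro i _; split_ifs
      · have := hm i; positivity
      · exact le_rfl
  have k1 : ∑ i, m i * y i ^ p = 2 ^ p * p * ∑ i, m i * ((y i / 2) ^ p / p) := by
    rw [Finset.mul_sum]
    refine Finset.sum_congr rfl fun i _ => ?_
    rw [Real.div_rpow (hy i) zero_le_two]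
    field_simp
  have k2 : ∑ i, m i * f i * (f i ^ (p - 1) / (p - 1)) = (p - 1)⁻¹ * ∑ i, m i * f i ^ p := by
    rw [Finset.mul_sum]
    refine Finset.sum_congr rfl fun i _ => ?_
    have : f i ^ p = f i * f i ^ (p - 1) := by
      rcases (hf i).eq_or_lt with h0 | h0
      · rw [← h0, Real.zero_rpow (by linarith), zero_mul]
      · rw [← Real.rpow_one_add' h0.le (by linarith)]; congr 1; ring
    rw [this]
    field_simp
  rw [k1, show 2 ^ p * (p / (p - 1)) * ∑ i, m i * f i ^ p =
    2 ^ p * p * ((p - 1)⁻¹ * ∑ i, m i * f i ^ p) by ring, ← k2]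
  gcongr

/-! ### Matrices acting on vectors with entries in `B` -/

/-- The orbit of the vector `v` with entries in `B` under the complex matrix `a`. -/
def matrixOrbit {ι B : Type*} [Fintype ι] [NormedAddCommGroup B] [NormedSpace ℂ B]
    (a : Matrix ι ι ℂ) (v : ι → B) : ℕ → ι → B
  | 0 => v
  | k + 1 => fun i => ∑ j, a i j • matrixOrbit a v k j

/-- Maximal ergodic inequality for a matrix that contracts `ℓ^∞` and the weighted `ℓ¹`, acting on
vectors with entries in a normed space. -/
theorem sum_matrixOrbit_average_rpow_le {ι B : Type*} [Fintype ι] [NormedAddCommGroup B]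
    [NormedSpace ℂ B] {m : ι → ℝ} (hm : ∀ i, 0 ≤ m i) {a : Matrix ι ι ℂ}
    (hrow : ∀ i, ∑ j, ‖a i j‖ ≤ 1) (hcol : ∀ j, ∑ i, m i * ‖a i j‖ ≤ m j)
    (v : ι → B) (ν : ι → ℕ) {p : ℝ} (hp : 1 < p) :
    ∑ i, m i * ‖((ν i : ℝ) + 1)⁻¹ • ∑ k ∈ Finset.range (ν i + 1), matrixOrbit a v k i‖ ^ p ≤
      2 ^ p * (p / (p - 1)) * ∑ i, m i * ‖v i‖ ^ p := by
  -- Entrywise absolute values: row sums give `P 1 ≤ 1`, column sums the `ℓ¹` contraction, and the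
  -- triangle inequality the domination of orbits.
  set P : Module.End ℝ (ι → ℝ) := Matrix.mulVecLin (fun i j => ‖a i j‖) with hPdef
  have hPa : ∀ f i, P f i = ∑ j, ‖a i j‖ * f j := fun f i => rfl
  have hP : IsSubMarkov m P := by
    refine ⟨fun f hf i => ?_, fun i => ?_, fun f hf => ?_⟩
    · rw [hPa]
      exact Finset.sum_nonneg fun j _ => mul_nonneg (norm_nonneg _) (hf j)
    · simpa [hPa] using hrow i
    · simp_rw [hPa, Finset.mul_sum]
      rw [Finset.sum_comm]
      refine Finset.sum_le_sum fun j _ => ?_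
      simp_rw [← mul_assoc]
      rw [← Finset.sum_mul]
      exact mul_le_mul_of_nonneg_right (hcol j) (hf j)
  have hdom : ∀ k i, ‖matrixOrbit a v k i‖ ≤ (P ^ k) (fun i => ‖v i‖) i := by
    intro k
    induction k with
    | zero => exact fun i => le_rfl
    | succ k ih =>
      intro i
      rw [pow_succ', Module.End.mul_apply, hPa]
      refine (norm_sum_le _ _).trans (Finset.sum_le_sum fun j _ => ?_)
      rw [norm_smul]
      exact mul_le_mul_of_nonneg_left (ih j) (norm_nonneg _)
  have hle : ∀ i, ‖((ν i : ℝ) + 1)⁻¹ • ∑ k ∈ Finset.range (ν i + 1), matrixOrbit a v k i‖ ≤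
      ((ν i : ℝ) + 1)⁻¹ * ∑ k ∈ Finset.range (ν i + 1), (P ^ k) (fun i => ‖v i‖) i := by
    intro i
    have hpos : (0 : ℝ) ≤ ((ν i : ℝ) + 1)⁻¹ := by positivity
    rw [norm_smul, Real.norm_of_nonneg hpos]
    exact mul_le_mul_of_nonneg_left
      ((norm_sum_le _ _).trans (Finset.sum_le_sum fun k _ => hdom k i)) hpos
  refine le_trans (Finset.sum_le_sum fun i _ => ?_) (sum_rpow_le_of_weak_type hm
    (fun i => norm_nonneg (v i)) (fun i => (norm_nonneg _).trans (hle i)) hp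
    (fun r hr => hP.weak_type hm _ ν hr))
  exact mul_le_mul_of_nonneg_left (Real.rpow_le_rpow (norm_nonneg _) (hle i) (by linarith)) (hm i)

/-! ### Representatives of sums and limits in `L^p` -/

theorem coeFn_finsetSum_Lp {X B κ : Type*} [MeasurableSpace X] {μ : Measure X} {p : ℝ≥0∞}
    [NormedAddCommGroup B] (s : Finset κ) (f : κ → Lp B p μ) :
    ⇑(∑ k ∈ s, f k) =ᵐ[μ] fun x => ∑ k ∈ s, f k x := by
  classical
  induction s using Finset.induction_on with
  | empty => simpa using! Lp.coeFn_zero B p μ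
  | insert a s ha ih =>
    rw [Finset.sum_insert ha]
    filter_upwards [Lp.coeFn_add (f a) (∑ k ∈ s, f k), ih] with x h1 h2
    rw [h1, Pi.add_apply, h2, Finset.sum_insert ha]

theorem exists_common_subseq_tendsto_ae {X B κ : Type*} [MeasurableSpace X] {μ : Measure X}
    {p : ℝ≥0∞} [Fact (1 ≤ p)] [NormedAddCommGroup B] (s : Finset κ) {f : κ → ℕ → Lp B p μ}
    {g : κ → Lp B p μ} (h : ∀ k ∈ s, Tendsto (f k) atTop (𝓝 (g k))) :
    ∃ φ : ℕ → ℕ, StrictMono φ ∧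
      ∀ᵐ x ∂μ, ∀ k ∈ s, Tendsto (fun n => f k (φ n) x) atTop (𝓝 (g k x)) := by
  classical
  induction s using Finset.induction_on with
  | empty => exact ⟨id, strictMono_id, by simp⟩
  | insert a s ha ih =>
    obtain ⟨φ, hφ, hφ'⟩ := ih fun k hk => h k (Finset.mem_insert_of_mem hk)
    obtain ⟨ψ, hψ, hψ'⟩ := (tendstoInMeasure_of_tendsto_Lp
      ((h a (Finset.mem_insert_self a s)).comp hφ.tendsto_atTop)).exists_seq_tendsto_ae
    refine ⟨φ ∘ ψ, hφ.comp hψ, ?_⟩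
    filter_upwards [hφ', hψ'] with x h1 h2 k hk
    rcases Finset.mem_insert.1 hk with rfl | hk
    · exact h2
    · exact (h1 k hk).comp hψ.tendsto_atTop

/-! ### Cells and compressions of operators -/

/-- A finite family of disjoint measurable sets of positive finite measure. -/
structure CellFamily {X : Type*} [MeasurableSpace X] (μ : Measure X) (ι : Type*) where
  cell : ι → Set X
  measurableSet : ∀ i, MeasurableSet (cell i)
  ne_top : ∀ i, μ (cell i) ≠ ∞
  ne_zero : ∀ i, μ (cell i) ≠ 0
  disjoint : Pairwise (Function.onFun Disjoint cell)

namespace CellFamily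

variable {X : Type*} [MeasurableSpace X] {μ : Measure X} {ι : Type*}
  (C : CellFamily μ ι)

/-- The indicator function of a cell, in `L²`. -/
noncomputable def ind (i : ι) : Lp ℂ 2 μ :=
  indicatorConstLp 2 (C.measurableSet i) (C.ne_top i) 1

/-- The measure of a cell. -/
noncomputable def mass (i : ι) : ℝ := μ.real (C.cell i)

theorem mass_pos (i : ι) : 0 < C.mass i :=
  ENNReal.toReal_pos (C.ne_zero i) (C.ne_top i)

theorem inner_ind_ind [DecidableEq ι] (i j : ι) :
    ⟪C.ind i, C.ind j⟫_ℂ = if i = j then (C.mass i : ℂ) else 0 := by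
  rw [ind, ind, L2.inner_indicatorConstLp_one_indicatorConstLp_one (C.measurableSet i)
    (C.measurableSet j) (C.ne_top i) (C.ne_top j)]
  split_ifs with h
  · subst h; simp [mass]
  · rw [(C.disjoint h).inter_eq]; simp

variable [Fintype ι]

theorem sum_indicator_of_mem {A : Type*} [AddCommMonoid A] (c : ι → A) {i : ι} {x : X}
    (hx : x ∈ C.cell i) : ∑ j, (C.cell j).indicator (fun _ => c j) x = c i := by
  classical
  rw [Finset.sum_eq_single i]
  · rw [Set.indicator_of_mem hx]
  · intro j _ hj
    exact Set.indicator_of_notMem (fun hxj => (C.disjoint hj).le_bot ⟨hxj, hx⟩) _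
  · simp

theorem sum_indicator_of_notMem {A : Type*} [AddCommMonoid A] (c : ι → A) {x : X}
    (hx : ∀ i, x ∉ C.cell i) : ∑ j, (C.cell j).indicator (fun _ => c j) x = 0 :=
  Finset.sum_eq_zero fun j _ => Set.indicator_of_notMem (hx j) _

theorem coeFn_sum_ind (c : ι → ℂ) :
    ⇑(∑ i, c i • C.ind i) =ᵐ[μ] fun x => ∑ i, (C.cell i).indicator (fun _ => c i) x := by
  have h : ∀ᵐ x ∂μ, ∀ i, (c i • C.ind i) x = (C.cell i).indicator (fun _ => c i) x := by
    refine ae_all_iff.2 fun i => ?_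
    filter_upwards [Lp.coeFn_smul (c i) (C.ind i), indicatorConstLp_coeFn (p := 2) (μ := μ)
      (hs := C.measurableSet i) (hμs := C.ne_top i) (c := (1 : ℂ))] with x h1 h2
    rw [h1, Pi.smul_apply, ind, h2]
    by_cases hx : x ∈ C.cell i <;> simp [hx]
  filter_upwards [coeFn_finsetSum_Lp Finset.univ fun i => c i • C.ind i, h] with x h1 h2
  rw [h1]
  exact Finset.sum_congr rfl fun i _ => h2 i

/-- The span of the indicator functions of the cells. -/
noncomputable def span : Submodule ℂ (Lp ℂ 2 μ) := Submodule.span ℂ (Set.range C.ind)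

instance : FiniteDimensional ℂ C.span := FiniteDimensional.span_of_finite ℂ (Set.finite_range _)

theorem sum_ind_mem_span (c : ι → ℂ) : ∑ i, c i • C.ind i ∈ C.span :=
  Submodule.sum_mem _ fun i _ => Submodule.smul_mem _ _ (Submodule.subset_span ⟨i, rfl⟩)

/-- The indicators are orthogonal with squared norm `mass`, so the coefficients are the means of `g`
over the cells. -/
theorem starProjection_span (g : Lp ℂ 2 μ) :
    C.span.starProjection g = ∑ i, ((C.mass i : ℂ)⁻¹ * ⟪C.ind i, g⟫_ℂ) • C.ind i := by
  classical
  have hind : ∀ i, C.ind i ∈ C.span := fun i => Submodule.subset_span ⟨i, rfl⟩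
  have hmem : C.span.starProjection g ∈ C.span := Submodule.starProjection_apply_mem _ _
  obtain ⟨c, hc⟩ := (Submodule.mem_span_range_iff_exists_fun ℂ).1 hmem
  rw [← hc]
  refine Finset.sum_congr rfl fun i _ => ?_
  have h1 : ⟪C.ind i, g - C.span.starProjection g⟫_ℂ = 0 := by
    rw [← inner_conj_symm, Submodule.starProjection_inner_eq_zero g (C.ind i) (hind i),
      map_zero]
  have h2 : ⟪C.ind i, g⟫_ℂ = C.mass i * c i := by
    rw [inner_sub_right, sub_eq_zero, ← hc, inner_sum] at h1
    rw [h1]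
    simp [inner_smul_right, inner_ind_ind, mul_comm]
  have h3 : (C.mass i : ℂ) ≠ 0 := by exact_mod_cast (C.mass_pos i).ne'
  rw [h2, inv_mul_cancel_left₀ h3]

/-- The matrix of the compression of `S` to the span of the indicator functions of the cells. -/
noncomputable def compression (S : Lp ℂ 2 μ →L[ℂ] Lp ℂ 2 μ) : Matrix ι ι ℂ :=
  fun i j => (C.mass i : ℂ)⁻¹ * ⟪C.ind i, S (C.ind j)⟫_ℂ

theorem compression_pow (S : Lp ℂ 2 μ →L[ℂ] Lp ℂ 2 μ) (c : ι → ℂ) (k : ℕ) :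
    ((C.span.starProjection.comp S) ^ k) (∑ i, c i • C.ind i) =
      ∑ i, matrixOrbit (C.compression S) c k i • C.ind i := by
  induction k with
  | zero => simp [matrixOrbit]
  | succ k ih =>
    rw [pow_succ', mul_apply_eq_comp, ih, ContinuousLinearMap.comp_apply,
      starProjection_span]
    refine Finset.sum_congr rfl fun i _ => ?_
    congr 1
    simp only [map_sum, map_smul, inner_sum, inner_smul_right, matrixOrbit, compression,
      Finset.mul_sum, smul_eq_mul]
    exact Finset.sum_congr rfl fun j _ => by ring

/-- The term `m_i |a_ij|` is the modulus of the integral of `S χ_j` over cell `i`. Disjointness of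
the cells bounds the sum over `i` by the `L¹` norm of `S χ_j`, hence by that of `χ_j`. -/
theorem compression_col_sum_le {S : Lp ℂ 2 μ →L[ℂ] Lp ℂ 2 μ}
    (hS : ∀ f : Lp ℂ 2 μ, MemLp f 1 μ → eLpNorm (S f) 1 μ ≤ eLpNorm f 1 μ) (j : ι) :
    ∑ i, C.mass i * ‖C.compression S i j‖ ≤ C.mass j := by
  have hmem : MemLp (C.ind j) 1 μ :=
    (memLp_indicator_const 1 (C.measurableSet j) (1 : ℂ) (Or.inr (C.ne_top j))).ae_eq
      indicatorConstLp_coeFn.symm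
  have hle := hS _ hmem
  have hnorm : eLpNorm (C.ind j) 1 μ = μ (C.cell j) := by
    rw [ind, eLpNorm_congr_ae (indicatorConstLp_coeFn (p := 2) (μ := μ)
      (hs := C.measurableSet j) (hμs := C.ne_top j) (c := (1 : ℂ))),
      eLpNorm_indicator_const (C.measurableSet j) one_ne_zero ENNReal.one_ne_top]
    simp
  have hint : Integrable (S (C.ind j)) μ :=
    memLp_one_iff_integrable.1 ⟨Lp.aestronglyMeasurable _, hle.trans_lt hmem.2⟩
  have h1 : ∀ i, C.mass i * ‖C.compression S i j‖ ≤ ∫ x in C.cell i, ‖S (C.ind j) x‖ ∂μ := by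
    intro i
    have h3 := C.mass_pos i
    rw [compression, norm_mul, norm_inv, Complex.norm_real, Real.norm_of_nonneg h3.le,
      mul_inv_cancel_left₀ h3.ne', ind, L2.inner_indicatorConstLp_one]
    exact norm_integral_le_integral_norm _
  calc ∑ i, C.mass i * ‖C.compression S i j‖
      ≤ ∑ i, ∫ x in C.cell i, ‖S (C.ind j) x‖ ∂μ := Finset.sum_le_sum fun i _ => h1 i
    _ = ∫ x in ⋃ i, C.cell i, ‖S (C.ind j) x‖ ∂μ :=
        (integral_iUnion_fintype C.measurableSet C.disjoint
          fun i => hint.norm.integrableOn).symm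
    _ ≤ ∫ x, ‖S (C.ind j) x‖ ∂μ :=
        setIntegral_le_integral hint.norm (Eventually.of_forall fun x => norm_nonneg _)
    _ ≤ C.mass j := by
        rw [integral_norm_eq_lintegral_enorm hint.1, ← eLpNorm_one_eq_lintegral_enorm]
        exact ENNReal.toReal_mono (C.ne_top j) (hle.trans hnorm.le)

/-- Weight the indicators by phases `c_j` that make each `c_j a_ij` equal to `|a_ij|`. The resulting
`g` is bounded by 1, hence so is `S g`, and the row sum is the mean of `S g` over cell `i`. -/
theorem compression_row_sum_le {S : Lp ℂ 2 μ →L[ℂ] Lp ℂ 2 μ}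
    (hS : ∀ f : Lp ℂ 2 μ, MemLp f ∞ μ → eLpNorm (S f) ∞ μ ≤ eLpNorm f ∞ μ) (i : ι) :
    ∑ j, ‖C.compression S i j‖ ≤ 1 := by
  have hphase : ∀ z : ℂ, ∃ c : ℂ, ‖c‖ ≤ 1 ∧ c * z = ‖z‖ := by
    intro z
    rcases eq_or_ne z 0 with rfl | hz
    · exact ⟨0, by simp, by simp⟩
    · refine ⟨‖z‖ / z, by simp [hz], by field_simp⟩
  choose c hc hcz using fun j => hphase (C.compression S i j)
  set g : Lp ℂ 2 μ := ∑ j, c j • C.ind j with hg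
  have hbound : ∀ᵐ x ∂μ, ‖g x‖ ≤ 1 := by
    filter_upwards [C.coeFn_sum_ind c] with x hx
    rw [hx]
    by_cases h : ∃ j, x ∈ C.cell j
    · obtain ⟨j, hj⟩ := h
      rw [C.sum_indicator_of_mem c hj]
      exact hc j
    · push Not at h
      rw [C.sum_indicator_of_notMem c h]
      simp
  have hgn : eLpNorm g ∞ μ ≤ 1 := by
    rw [eLpNorm_exponent_top]
    simpa using eLpNormEssSup_le_of_ae_bound hbound
  have hSg : eLpNorm (S g) ∞ μ ≤ 1 :=
    (hS g ⟨Lp.aestronglyMeasurable _, hgn.trans_lt ENNReal.one_lt_top⟩).trans hgn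
  have hSb : ∀ᵐ x ∂μ, ‖S g x‖ ≤ 1 := by
    rw [eLpNorm_exponent_top] at hSg
    filter_upwards [ae_le_eLpNormEssSup (f := S g) (μ := μ)] with x hx
    have := hx.trans hSg
    rw [← ofReal_norm, ← ENNReal.ofReal_one] at this
    exact (ENNReal.ofReal_le_ofReal_iff zero_le_one).1 this
  have hint : ‖⟪C.ind i, S g⟫_ℂ‖ ≤ C.mass i := by
    rw [ind, L2.inner_indicatorConstLp_one]
    refine (norm_setIntegral_le_of_norm_le_const_ae (C.ne_top i).lt_top
      (C := 1) (ae_restrict_of_ae hSb)).trans ?_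
    simp [mass]
  have hm := C.mass_pos i
  have hsum : ((∑ j, ‖C.compression S i j‖ : ℝ) : ℂ) = (C.mass i : ℂ)⁻¹ * ⟪C.ind i, S g⟫_ℂ := by
    rw [hg, Complex.ofReal_sum]
    simp only [map_sum, map_smul, inner_sum, inner_smul_right, Finset.mul_sum, ← hcz]
    exact Finset.sum_congr rfl fun j _ => by rw [compression]; ring
  have hnn : 0 ≤ ∑ j, ‖C.compression S i j‖ := Finset.sum_nonneg fun j _ => norm_nonneg _
  calc ∑ j, ‖C.compression S i j‖ = ‖((∑ j, ‖C.compression S i j‖ : ℝ) : ℂ)‖ := by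
        rw [Complex.norm_real, Real.norm_of_nonneg hnn]
    _ ≤ (C.mass i)⁻¹ * C.mass i := by
        rw [hsum, norm_mul, norm_inv, Complex.norm_real, Real.norm_of_nonneg hm.le]
        gcongr
    _ = 1 := inv_mul_cancel₀ hm.ne'

/-- Scalar orbits tensored with vectors of `B` add up to the orbit of the `B`-valued vector; this is
how the scalar compression acts on tensors. -/
theorem matrixOrbit_sum_smul {L B : Type*} [Fintype L] [NormedAddCommGroup B] [NormedSpace ℂ B]
    (a : Matrix ι ι ℂ) (c : L → ι → ℂ) (u : L → B) (k : ℕ) (i : ι) :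
    ∑ l, matrixOrbit a (c l) k i • u l = matrixOrbit a (fun i => ∑ l, c l i • u l) k i := by
  induction k generalizing i with
  | zero => rfl
  | succ k ih =>
    simp only [matrixOrbit, Finset.sum_smul, ← ih, Finset.smul_sum, smul_eq_mul, mul_smul]
    exact Finset.sum_comm

theorem lintegral_sum_indicator (w : ι → ℝ≥0∞) :
    ∫⁻ x, ∑ i, (C.cell i).indicator (fun _ => w i) x ∂μ = ∑ i, w i * μ (C.cell i) := by
  rw [lintegral_finsetSum _ fun i _ => measurable_const.indicator (C.measurableSet i)]
  exact Finset.sum_congr rfl fun i _ => lintegral_indicator_const (C.measurableSet i) _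

/-- Maximal ergodic inequality for the compression of a contraction to a finite family of cells. -/
theorem lintegral_sup_average_compression_le {L B : Type*} [Fintype L] [NormedAddCommGroup B]
    [NormedSpace ℂ B] {S : Lp ℂ 2 μ →L[ℂ] Lp ℂ 2 μ}
    (h1 : ∀ f : Lp ℂ 2 μ, MemLp f 1 μ → eLpNorm (S f) 1 μ ≤ eLpNorm f 1 μ)
    (hinf : ∀ f : Lp ℂ 2 μ, MemLp f ∞ μ → eLpNorm (S f) ∞ μ ≤ eLpNorm f ∞ μ)
    {f : L → Lp ℂ 2 μ} (hf : ∀ l, f l ∈ C.span) (u : L → B) (N : ℕ) {p : ℝ} (hp : 1 < p) :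
    ∫⁻ x, ((Finset.range (N + 1)).sup fun n => ‖((n : ℝ) + 1)⁻¹ • ∑ k ∈ Finset.range (n + 1),
        ∑ l, (((C.span.starProjection.comp S) ^ k) (f l) : X → ℂ) x • u l‖ₑ) ^ p ∂μ ≤
      ENNReal.ofReal (2 ^ p * (p / (p - 1))) * ∫⁻ x, ‖∑ l, (f l : X → ℂ) x • u l‖ₑ ^ p ∂μ := by
  have hp0 : 0 < p := by linarith
  choose c hc using fun l => (Submodule.mem_span_range_iff_exists_fun ℂ).1 (hf l)
  set a := C.compression S
  set v : ι → B := fun i => ∑ l, c l i • u l with hv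
  have hae : ∀ᵐ x ∂μ, ∀ k l, (((C.span.starProjection.comp S) ^ k) (f l) : X → ℂ) x =
      ∑ i, (C.cell i).indicator (fun _ => matrixOrbit a (c l) k i) x := by
    refine ae_all_iff.2 fun k => ae_all_iff.2 fun l => ?_
    rw [← hc l, C.compression_pow]
    exact C.coeFn_sum_ind _
  have hin : ∀ᵐ x ∂μ, ∀ i, x ∈ C.cell i → ∀ k,
      ∑ l, (((C.span.starProjection.comp S) ^ k) (f l) : X → ℂ) x • u l = matrixOrbit a v k i := by
    filter_upwards [hae] with x hx i hi k
    simp_rw [hx, C.sum_indicator_of_mem _ hi]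
    exact matrixOrbit_sum_smul a c u k i
  have hout : ∀ᵐ x ∂μ, (∀ i, x ∉ C.cell i) → ∀ k,
      ∑ l, (((C.span.starProjection.comp S) ^ k) (f l) : X → ℂ) x • u l = 0 := by
    filter_upwards [hae] with x hx hi k
    simp_rw [hx, C.sum_indicator_of_notMem _ hi, zero_smul, Finset.sum_const_zero]
  have hL : ∀ᵐ x ∂μ, ((Finset.range (N + 1)).sup fun n => ‖((n : ℝ) + 1)⁻¹ •
        ∑ k ∈ Finset.range (n + 1),
        ∑ l, (((C.span.starProjection.comp S) ^ k) (f l) : X → ℂ) x • u l‖ₑ) ^ p =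
      ∑ i, (C.cell i).indicator (fun _ => ((Finset.range (N + 1)).sup fun n =>
        ‖((n : ℝ) + 1)⁻¹ • ∑ k ∈ Finset.range (n + 1), matrixOrbit a v k i‖ₑ) ^ p) x := by
    filter_upwards [hin, hout] with x h1 h2
    by_cases h : ∃ i, x ∈ C.cell i
    · obtain ⟨i, hi⟩ := h
      rw [C.sum_indicator_of_mem _ hi]
      simp_rw [h1 i hi]
    · push Not at h
      rw [C.sum_indicator_of_notMem _ h]
      simp_rw [h2 h]
      simp [hp0]
  have hR : ∀ᵐ x ∂μ, ‖∑ l, (f l : X → ℂ) x • u l‖ₑ ^ p =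
      ∑ i, (C.cell i).indicator (fun _ => ‖v i‖ₑ ^ p) x := by
    filter_upwards [hin, hout] with x h1 h2
    by_cases h : ∃ i, x ∈ C.cell i
    · obtain ⟨i, hi⟩ := h
      rw [C.sum_indicator_of_mem _ hi]
      have := h1 i hi 0
      simp only [pow_zero, one_apply_eq_self] at this
      rw [this]; rfl
    · push Not at h
      rw [C.sum_indicator_of_notMem _ h]
      have := h2 h 0
      simp only [pow_zero, one_apply_eq_self] at this
      rw [this]
      simp [hp0]
  rw [lintegral_congr_ae hL, lintegral_congr_ae hR, C.lintegral_sum_indicator,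
    C.lintegral_sum_indicator]
  -- On each cell the finite supremum is attained at some index; this is why the matrix inequality
  -- allows `ν` to depend on the point.
  choose ν hν hν' using fun i => Finset.exists_mem_eq_sup (Finset.range (N + 1)) ⟨0, by simp⟩
    (fun n => ‖((n : ℝ) + 1)⁻¹ • ∑ k ∈ Finset.range (n + 1), matrixOrbit a v k i‖ₑ)
  simp_rw [hν']
  have hconv : ∀ (w : B) (i : ι), ‖w‖ₑ ^ p * μ (C.cell i) =
      ENNReal.ofReal (C.mass i * ‖w‖ ^ p) := by
    intro w i
    rw [ENNReal.ofReal_mul (C.mass_pos i).le, ← ENNReal.ofReal_rpow_of_nonneg (norm_nonneg _)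
      hp0.le, ofReal_norm, mass, ofReal_measureReal (C.ne_top i), mul_comm]
  have hm0 : ∀ i, 0 ≤ C.mass i := fun i => (C.mass_pos i).le
  have hp1 : 0 < p - 1 := by linarith
  simp_rw [hconv]
  rw [← ENNReal.ofReal_sum_of_nonneg fun i _ => by have := hm0 i; positivity,
    ← ENNReal.ofReal_sum_of_nonneg fun i _ => by have := hm0 i; positivity,
    ← ENNReal.ofReal_mul (by positivity)]
  exact ENNReal.ofReal_le_ofReal (sum_matrixOrbit_average_rpow_le hm0
    (C.compression_row_sum_le hinf) (C.compression_col_sum_le h1) v ν hp)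

end CellFamily

/-! ### Approximation by compressions and the discrete inequality for simple functions -/

/-- Finitely many simple functions in `L²` are, up to null sets, linear combinations of the
indicator functions of a common finite family of cells. -/
theorem exists_cellFamily {X : Type*} [MeasurableSpace X] {μ : Measure X} {τ : Type*} [Finite τ]
    (h : τ → SimpleFunc X ℂ) (hmem : ∀ t, MemLp (h t) 2 μ) :
    ∃ (n : ℕ) (C : CellFamily μ (Fin n)), ∀ (t : τ) (g : Lp ℂ 2 μ), g =ᵐ[μ] h t → g ∈ C.span := by
  classical
  have := Fintype.ofFinite τ
  set H : X → τ → ℂ := fun x t => h t x with hH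
  have hfin : (Set.range H).Finite := by
    refine (Set.Finite.pi' fun t => (h t).finite_range).subset ?_
    rintro _ ⟨x, rfl⟩ t
    exact ⟨x, rfl⟩
  have hmeas : ∀ v, MeasurableSet (H ⁻¹' {v}) := by
    intro v
    have : H ⁻¹' {v} = ⋂ t, h t ⁻¹' {v t} := by
      ext x
      simp [hH, funext_iff]
    rw [this]
    exact MeasurableSet.iInter fun t => (h t).measurableSet_preimage _
  -- The cells are the level sets of the joint value map. The value 0 is dropped since its level set
  -- may have infinite measure, and null level sets are dropped since a cell must have positive
  -- mass.
  set V : Set (τ → ℂ) := {v | v ∈ Set.range H ∧ v ≠ 0 ∧ μ (H ⁻¹' {v}) ≠ 0} with hV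
  have hVfin : V.Finite := hfin.subset fun v hv => hv.1
  have := hVfin.fintype
  set e := (Fintype.equivFin V).symm with he
  refine ⟨Fintype.card V, ⟨fun i => H ⁻¹' {(e i : τ → ℂ)}, fun i => hmeas _, fun i => ?_,
    fun i => (e i).2.2.2, fun i j hij => ?_⟩, ?_⟩
  · obtain ⟨t, ht⟩ := Function.ne_iff.1 (e i).2.2.1
    refine ((measure_mono fun x hx => ?_).trans_lt
      (SimpleFunc.measure_preimage_lt_top_of_memLp two_ne_zero ENNReal.ofNat_ne_top (h t) (hmem t)
        ((e i : τ → ℂ) t) ht)).ne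
    exact congrFun hx t
  · refine Set.disjoint_left.2 fun x hx hx' => hij ?_
    exact e.injective (Subtype.ext (hx.symm.trans hx'))
  · intro t g hg
    set C : CellFamily μ (Fin (Fintype.card V)) := ⟨_, _, _, _, _⟩
    have hnull : ∀ᵐ x ∂μ, ∀ v ∈ Set.range H, μ (H ⁻¹' {v}) = 0 → H x ≠ v := by
      refine (ae_ball_iff hfin.countable).2 fun v _ => ?_
      by_cases h0 : μ (H ⁻¹' {v}) = 0
      · filter_upwards [measure_eq_zero_iff_ae_notMem.1 h0] with x hx _
        exact hx
      · exact Eventually.of_forall fun x h1 => absurd h1 h0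
    have : g = ∑ i, (e i : τ → ℂ) t • C.ind i := by
      refine Lp.ext ?_
      filter_upwards [hg, C.coeFn_sum_ind fun i => (e i : τ → ℂ) t, hnull] with x h1 h2 h3
      rw [h1, h2]
      by_cases hx : H x = 0
      · rw [C.sum_indicator_of_notMem]
        · exact congrFun hx t
        · intro i hi
          exact (e i).2.2.1 ((show H x = e i from hi).symm.trans hx)
      · have hxV : H x ∈ V := ⟨⟨x, rfl⟩, hx, fun h0 => h3 _ ⟨x, rfl⟩ h0 rfl⟩
        have hmemx : x ∈ C.cell (e.symm ⟨H x, hxV⟩) := by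
          change H x = e (e.symm ⟨H x, hxV⟩)
          simp
        rw [C.sum_indicator_of_mem _ hmemx]
        simp [hH]
    rw [this]
    exact C.sum_ind_mem_span _

theorem aemeasurable_finset_sup {X κ : Type*} [MeasurableSpace X] {μ : Measure X} (s : Finset κ)
    {f : κ → X → ℝ≥0∞} (hf : ∀ k, AEMeasurable (f k) μ) :
    AEMeasurable (fun x => s.sup fun k => f k x) μ := by
  simp_rw [Finset.sup_eq_iSup]
  exact AEMeasurable.biSup (s : Set κ) s.countable_toSet fun k _ => hf k

/-- Compressions to suitable finite families of cells approximate the first powers of a contraction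
on given vectors. -/
theorem exists_cellFamily_compression_close {X L : Type*} [MeasurableSpace X] {μ : Measure X}
    [Fintype L] {S : Lp ℂ 2 μ →L[ℂ] Lp ℂ 2 μ} (hS : ‖S‖ ≤ 1) (h : L → SimpleFunc X ℂ)
    (hmem : ∀ l, MemLp (h l) 2 μ) {f : L → Lp ℂ 2 μ} (hf : ∀ l, f l =ᵐ[μ] h l) (N : ℕ)
    {ε : ℝ} (hε : 0 < ε) :
    ∃ (n : ℕ) (C : CellFamily μ (Fin n)), (∀ l, f l ∈ C.span) ∧ ∀ k ≤ N, ∀ l,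
      ‖((C.span.starProjection.comp S) ^ k) (f l) - (S ^ k) (f l)‖ ≤ k * ε := by
  -- The cells will also resolve simple functions close to the vectors `S^k f_l`, `k ≤ N`, so that
  -- the projection nearly fixes these vectors.
  have happ : ∀ (k : Fin (N + 1)) (l : L), ∃ g : SimpleFunc X ℂ,
      eLpNorm (⇑((S ^ (k : ℕ)) (f l)) - ⇑g) 2 μ < ENNReal.ofReal ε ∧ MemLp g 2 μ := fun k l =>
    (Lp.memLp _).exists_simpleFunc_eLpNorm_sub_lt ENNReal.ofNat_ne_top
      (ENNReal.ofReal_pos.2 hε).ne'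
  choose g hg hgmem using happ
  obtain ⟨n, C, hC⟩ := exists_cellFamily (μ := μ)
    (Sum.elim h fun t : Fin (N + 1) × L => g t.1 t.2)
    (by rintro (l | ⟨k, l⟩); exacts [hmem l, hgmem k l])
  have hproj : ∀ k ≤ N, ∀ l,
      ‖C.span.starProjection ((S ^ k) (f l)) - (S ^ k) (f l)‖ ≤ ε := by
    intro k hk l
    have hk' : k < N + 1 := by omega
    have hmemC : (hgmem ⟨k, hk'⟩ l).toLp _ ∈ C.span :=
      hC (Sum.inr (⟨k, hk'⟩, l)) _ (MemLp.coeFn_toLp _)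
    rw [norm_sub_rev, Submodule.starProjection_minimal]
    refine (ciInf_le ⟨0, Set.forall_mem_range.2 fun _ => norm_nonneg _⟩
      (⟨_, hmemC⟩ : C.span)).trans ?_
    change ‖(S ^ k) (f l) - (hgmem ⟨k, hk'⟩ l).toLp _‖ ≤ ε
    rw [Lp.norm_def]
    refine ENNReal.toReal_le_of_le_ofReal hε.le ?_
    refine le_trans (le_of_eq (eLpNorm_congr_ae ?_)) (hg ⟨k, hk'⟩ l).le
    filter_upwards [Lp.coeFn_sub ((S ^ k) (f l)) ((hgmem ⟨k, hk'⟩ l).toLp _),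
      (hgmem ⟨k, hk'⟩ l).coeFn_toLp] with x h1 h2
    rw [h1, Pi.sub_apply, h2, Pi.sub_apply]
  refine ⟨n, C, fun l => hC (Sum.inl l) _ (hf l), fun k => ?_⟩
  induction k with
  | zero => intro _ l; simp
  | succ k ih =>
    intro hk l
    set Q := C.span.starProjection
    -- Both `Q` and `S` are contractions, so each power adds at most one projection error `ε`.
    have e : ((Q.comp S) ^ (k + 1)) (f l) - (S ^ (k + 1)) (f l) =
        Q (S (((Q.comp S) ^ k) (f l) - (S ^ k) (f l))) +
          (Q ((S ^ (k + 1)) (f l)) - (S ^ (k + 1)) (f l)) := by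
      rw [pow_succ', pow_succ', mul_apply_eq_comp, mul_apply_eq_comp, map_sub, map_sub,
        ContinuousLinearMap.comp_apply]
      abel
    rw [e]
    have hQ : ∀ y, ‖Q y‖ ≤ ‖y‖ := fun y =>
      (Q.le_of_opNorm_le C.span.starProjection_norm_le y).trans (one_mul _).le
    have hS' : ∀ y, ‖S y‖ ≤ ‖y‖ := fun y => (S.le_of_opNorm_le hS y).trans (one_mul _).le
    calc _ ≤ ‖((Q.comp S) ^ k) (f l) - (S ^ k) (f l)‖ + ε :=
          (norm_add_le _ _).trans (add_le_add ((hQ _).trans (hS' _)) (hproj _ hk l))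
      _ ≤ k * ε + ε := by gcongr; exact ih (by omega) l
      _ = _ := by push_cast; ring

/-- Discrete maximal ergodic inequality, for finite sums of simple functions with coefficients in a
normed space. -/
theorem lintegral_sup_average_simpleFunc_le {X L B : Type*} [MeasurableSpace X] {μ : Measure X}
    [Fintype L] [NormedAddCommGroup B] [NormedSpace ℂ B] {S : Lp ℂ 2 μ →L[ℂ] Lp ℂ 2 μ}
    (hS : ‖S‖ ≤ 1)
    (h1 : ∀ f : Lp ℂ 2 μ, MemLp f 1 μ → eLpNorm (S f) 1 μ ≤ eLpNorm f 1 μ)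
    (hinf : ∀ f : Lp ℂ 2 μ, MemLp f ∞ μ → eLpNorm (S f) ∞ μ ≤ eLpNorm f ∞ μ)
    (h : L → SimpleFunc X ℂ) (hmem : ∀ l, MemLp (h l) 2 μ) {f : L → Lp ℂ 2 μ}
    (hf : ∀ l, f l =ᵐ[μ] h l) (u : L → B) (N : ℕ) {p : ℝ} (hp : 1 < p) :
    ∫⁻ x, ((Finset.range (N + 1)).sup fun n => ‖((n : ℝ) + 1)⁻¹ • ∑ k ∈ Finset.range (n + 1),
        ∑ l, ((S ^ k) (f l) : X → ℂ) x • u l‖ₑ) ^ p ∂μ ≤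
      ENNReal.ofReal (2 ^ p * (p / (p - 1))) * ∫⁻ x, ‖∑ l, (f l : X → ℂ) x • u l‖ₑ ^ p ∂μ := by
  choose n C hC hclose using fun m : ℕ =>
    exists_cellFamily_compression_close hS h hmem hf N (ε := 1 / ((m : ℝ) + 1)) (by positivity)
  have hlim : ∀ t ∈ Finset.range (N + 1) ×ˢ (Finset.univ : Finset L),
      Tendsto (fun m => (((C m).span.starProjection.comp S) ^ t.1) (f t.2)) atTop
        (𝓝 ((S ^ t.1) (f t.2))) := by
    rintro ⟨k, l⟩ ht
    have hk : k ≤ N := by simp at ht; omega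
    rw [tendsto_iff_norm_sub_tendsto_zero]
    refine squeeze_zero (fun m => norm_nonneg _) (fun m => hclose m k hk l) ?_
    simpa using (tendsto_one_div_add_atTop_nhds_zero_nat (𝕜 := ℝ)).const_mul (k : ℝ)
  obtain ⟨φ, -, hφ⟩ := exists_common_subseq_tendsto_ae _ hlim
  set G : ℕ → X → ℝ≥0∞ := fun m x => ((Finset.range (N + 1)).sup fun n => ‖((n : ℝ) + 1)⁻¹ •
    ∑ k ∈ Finset.range (n + 1), ∑ l,
      ((((C (φ m)).span.starProjection.comp S) ^ k) (f l) : X → ℂ) x • u l‖ₑ) ^ p with hG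
  have hGm : ∀ m, AEMeasurable (G m) μ := by
    intro m
    refine (aemeasurable_finset_sup _ fun n => ?_).pow_const p
    refine AEStronglyMeasurable.enorm ?_
    refine AEStronglyMeasurable.const_smul ?_ _
    refine Finset.aestronglyMeasurable_fun_sum _ fun k _ =>
      Finset.aestronglyMeasurable_fun_sum _ fun l _ =>
        (Lp.aestronglyMeasurable _).smul_const _
  have hGlim : ∀ᵐ x ∂μ, Tendsto (fun m => G m x) atTop
      (𝓝 (((Finset.range (N + 1)).sup fun n => ‖((n : ℝ) + 1)⁻¹ • ∑ k ∈ Finset.range (n + 1),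
        ∑ l, ((S ^ k) (f l) : X → ℂ) x • u l‖ₑ) ^ p)) := by
    filter_upwards [hφ] with x hx
    refine Tendsto.ennrpow_const p ?_
    refine Tendsto.finset_sup_nhds_apply (L := ℝ≥0∞) fun n hn => ?_
    refine Tendsto.enorm ?_
    refine Tendsto.const_smul ?_ _
    refine tendsto_finsetSum _ fun k hk => tendsto_finsetSum _ fun l _ => ?_
    refine Tendsto.smul_const (hx (k, l) ?_) _
    simp at hn hk ⊢
    omega
  -- Fatou's lemma along the common almost everywhere convergent subsequence; the bound does not
  -- depend on the cells.
  calc _ = ∫⁻ x, liminf (fun m => G m x) atTop ∂μ :=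
        lintegral_congr_ae (hGlim.mono fun x hx => hx.liminf_eq.symm)
    _ ≤ liminf (fun m => ∫⁻ x, G m x ∂μ) atTop := lintegral_liminf_le' hGm
    _ ≤ liminf (fun _ : ℕ => ENNReal.ofReal (2 ^ p * (p / (p - 1))) *
          ∫⁻ x, ‖∑ l, (f l : X → ℂ) x • u l‖ₑ ^ p ∂μ) atTop :=
        liminf_le_liminf (Eventually.of_forall fun m =>
          (C (φ m)).lintegral_sup_average_compression_le h1 hinf (hC _) u N hp)
    _ = _ := liminf_const _

/-! ### Strongly continuous semigroups, ergodic averages and Riemann sums -/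

section StronglyContinuous

variable {E : Type*} [NormedAddCommGroup E] [NormedSpace ℂ E]

theorem continuous_orbit_of_dense {T : ℝ≥0 → E →L[ℂ] E} {K : ℝ} (hK : ∀ t, ‖T t‖ ≤ K)
    {D : Set E} (hD : Dense D) (h : ∀ f ∈ D, Continuous fun t => T t f) (f : E) :
    Continuous fun t => T t f := by
  refine continuous_of_uniform_approx_of_continuous fun u hu => ?_
  obtain ⟨ε, hε, hu⟩ := Metric.mem_uniformity_dist.1 hu
  have hK0 : 0 ≤ K := (norm_nonneg _).trans (hK 0)
  obtain ⟨g, hg, hfg⟩ := Metric.dense_iff.1 hD f (ε / (K + 1)) (by positivity)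
  refine ⟨fun t => T t g, h g hfg, fun t => hu ?_⟩
  rw [Metric.mem_ball, dist_comm, dist_eq_norm, lt_div_iff₀ (by positivity)] at hg
  rw [dist_eq_norm, ← map_sub]
  refine ((T t).le_of_opNorm_le (hK t) _).trans_lt ?_
  nlinarith [norm_nonneg (f - g)]

namespace IsStronglyContinuousSemigroup

variable {T : ℝ≥0 → E →L[ℂ] E}

theorem continuous_toNNReal (hT : IsStronglyContinuousSemigroup T) (f : E) :
    Continuous fun s : ℝ => T s.toNNReal f :=
  (hT.continuous f).comp continuous_real_toNNReal

theorem pow_eq (hT : IsStronglyContinuousSemigroup T) (t : ℝ≥0) (k : ℕ) :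
    T t ^ k = T (k * t) := by
  induction k with
  | zero => simp [hT.zero]; rfl
  | succ k ih =>
    rw [pow_succ', ih, Nat.cast_succ, add_mul, one_mul, add_comm, hT.add]
    rfl

/-- The ergodic average of a bounded semigroup is a bounded operator. -/
theorem exists_ergodicAverage_eq (hT : IsStronglyContinuousSemigroup T) {K : ℝ}
    (hK : ∀ t, ‖T t‖ ≤ K) (t : ℝ≥0) : ∃ A : E →L[ℂ] E, ∀ f, A f = ergodicAverage T t f := by
  have hint : ∀ f, IntervalIntegrable (fun s : ℝ => T s.toNNReal f) volume 0 t := fun f =>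
    (hT.continuous_toNNReal f).intervalIntegrable _ _
  refine ⟨LinearMap.mkContinuous
    { toFun := ergodicAverage T t
      map_add' := fun f g => ?_
      map_smul' := fun c f => ?_ } (‖(t : ℝ)⁻¹‖ * (K * |(t : ℝ) - 0|)) fun f => ?_, fun f => rfl⟩
  · simp only [ergodicAverage, map_add]
    rw [intervalIntegral.integral_add (hint f) (hint g), smul_add]
  · simp only [ergodicAverage, map_smul, RingHom.id_apply]
    rw [intervalIntegral.integral_smul, smul_comm]
  · change ‖ergodicAverage T t f‖ ≤ _
    rw [ergodicAverage, norm_smul, mul_assoc]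
    refine mul_le_mul_of_nonneg_left ?_ (norm_nonneg _)
    refine (intervalIntegral.norm_integral_le_of_norm_le_const (C := K * ‖f‖) fun s _ =>
      (T _).le_of_opNorm_le (hK _) f).trans (le_of_eq ?_)
    ring

theorem continuousAt_ergodicAverage (hT : IsStronglyContinuousSemigroup T) (f : E) {t : ℝ≥0}
    (ht : 0 < t) : ContinuousAt (fun t => ergodicAverage T t f) t := by
  have h1 : ContinuousAt (fun t : ℝ≥0 => (t : ℝ)⁻¹) t :=
    NNReal.continuous_coe.continuousAt.inv₀ (by exact_mod_cast ht.ne')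
  have h2 : Continuous fun t : ℝ≥0 => ∫ s in (0 : ℝ)..t, T s.toNNReal f :=
    (intervalIntegral.continuous_primitive (fun a b =>
      (hT.continuous_toNNReal f).intervalIntegrable a b) 0).comp NNReal.continuous_coe
  exact h1.smul h2.continuousAt

end IsStronglyContinuousSemigroup

/-- Convergence of left Riemann sums. -/
theorem tendsto_riemannSum [CompleteSpace E] {φ : ℝ → E} (hφ : Continuous φ) {t : ℝ}
    (ht : 0 < t) :
    Tendsto (fun n : ℕ => ((n : ℝ) + 1)⁻¹ • ∑ k ∈ Finset.range (n + 1), φ (k * (t / (n + 1))))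
      atTop (𝓝 (t⁻¹ • ∫ s in (0 : ℝ)..t, φ s)) := by
  rw [Metric.tendsto_atTop]
  intro ε hε
  obtain ⟨δ, hδ, hu⟩ := Metric.uniformContinuousOn_iff.1
    (isCompact_Icc.uniformContinuousOn_of_continuous hφ.continuousOn (s := Set.Icc 0 t))
    (ε / 2) (by positivity)
  have hlim : Tendsto (fun n : ℕ => t / ((n : ℝ) + 1)) atTop (𝓝 0) := by
    simpa [div_eq_mul_inv] using
      (tendsto_one_div_add_atTop_nhds_zero_nat (𝕜 := ℝ)).const_mul t
  obtain ⟨N, hN⟩ := eventually_atTop.1 (hlim.eventually (gt_mem_nhds hδ))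
  refine ⟨N, fun n hn => ?_⟩
  have hn1 : (0 : ℝ) < (n : ℝ) + 1 := by positivity
  set h := t / ((n : ℝ) + 1) with hh
  have hh0 : 0 < h := by positivity
  have hhδ : h < δ := hN n hn
  have hth : ((n : ℝ) + 1) * h = t := by rw [hh]; field_simp
  have hsplit : ∫ s in (0 : ℝ)..t, φ s =
      ∑ k ∈ Finset.range (n + 1), ∫ s in (k * h)..((k + 1 : ℕ) * h), φ s := by
    rw [intervalIntegral.sum_integral_adjacent_intervals (a := fun k : ℕ => (k : ℝ) * h)
      fun k _ => hφ.intervalIntegrable _ _]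
    push_cast
    rw [hth, zero_mul]
  have hsum : ((n : ℝ) + 1)⁻¹ • ∑ k ∈ Finset.range (n + 1), φ (k * h) =
      t⁻¹ • ∑ k ∈ Finset.range (n + 1), ∫ _ in (k * h)..((k + 1 : ℕ) * h), φ (k * h) := by
    simp_rw [intervalIntegral.integral_const]
    push_cast
    simp_rw [add_mul, one_mul, add_sub_cancel_left]
    rw [← Finset.smul_sum, smul_smul]
    congr 1
    rw [hh]; field_simp
  rw [hsum, hsplit, dist_eq_norm, ← smul_sub, ← Finset.sum_sub_distrib, norm_smul,
    Real.norm_of_nonneg (by positivity)]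
  have hterm : ∀ k ∈ Finset.range (n + 1),
      ‖(∫ _ in (k * h)..((k + 1 : ℕ) * h), φ (k * h)) -
        ∫ s in (k * h)..((k + 1 : ℕ) * h), φ s‖ ≤ ε / 2 * h := by
    intro k hk
    have hk' : (k : ℝ) + 1 ≤ (n : ℝ) + 1 := by
      have := Finset.mem_range.1 hk
      exact_mod_cast this
    rw [← intervalIntegral.integral_sub (continuous_const.intervalIntegrable _ _)
      (hφ.intervalIntegrable _ _)]
    have hle : (k : ℝ) * h ≤ ((k + 1 : ℕ) : ℝ) * h := by push_cast; nlinarith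
    refine (intervalIntegral.norm_integral_le_of_norm_le_const (C := ε / 2) fun s hs => ?_).trans
      (le_of_eq ?_)
    · rw [Set.uIoc_of_le hle] at hs
      have h1 : 0 ≤ (k : ℝ) * h := by positivity
      have h2 : ((k + 1 : ℕ) : ℝ) * h ≤ t := by
        push_cast; rw [← hth]; gcongr
      have h3 : s ≤ k * h + h := by have := hs.2; push_cast at this; linarith
      rw [← dist_eq_norm]
      refine (hu _ ⟨h1, hle.trans h2⟩ s ⟨h1.trans hs.1.le, hs.2.trans h2⟩ ?_).le
      rw [Real.dist_eq, abs_sub_comm, abs_of_nonneg (by linarith [hs.1])]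
      linarith
    · push_cast
      rw [show ((k : ℝ) + 1) * h - k * h = h by ring, abs_of_pos hh0]
  calc _ ≤ t⁻¹ * ∑ k ∈ Finset.range (n + 1), ε / 2 * h := by
        refine mul_le_mul_of_nonneg_left ?_ (by positivity)
        exact (norm_sum_le _ _).trans (Finset.sum_le_sum hterm)
    _ = ε / 2 := by
        rw [Finset.sum_const, Finset.card_range, nsmul_eq_mul]
        push_cast
        rw [show t⁻¹ * (((n : ℝ) + 1) * (ε / 2 * h)) = t⁻¹ * (((n : ℝ) + 1) * h) * (ε / 2) by ring,
          hth, inv_mul_cancel₀ ht.ne', one_mul]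
    _ < ε := by linarith

end StronglyContinuous

/-! ### Extension from `L²` to `L^p` -/

section LpExtension

variable {X : Type*} [MeasurableSpace X] {μ : Measure X} {p : ℝ≥0∞}

theorem dense_simpleFunc_Lp {B : Type*} [NormedAddCommGroup B] [Fact (1 ≤ p)] (hp : p ≠ ∞) :
    Dense {g : Lp B p μ | ∃ h : SimpleFunc X B, h.FinMeasSupp μ ∧ g =ᵐ[μ] h} := by
  have hp0 : p ≠ 0 := (zero_lt_one.trans_le (Fact.out : 1 ≤ p)).ne'
  refine Metric.dense_iff.2 fun f ε hε => ?_
  obtain ⟨h, hh, hmem⟩ := (Lp.memLp f).exists_simpleFunc_eLpNorm_sub_lt hp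
    (ENNReal.ofReal_pos.2 hε).ne'
  refine ⟨hmem.toLp h, ?_, h, (SimpleFunc.memLp_iff_finMeasSupp hp0 hp).1 hmem, hmem.coeFn_toLp⟩
  rw [Metric.mem_ball, dist_comm, Lp.dist_def]
  refine ENNReal.toReal_lt_of_lt_ofReal (lt_of_le_of_lt (le_of_eq (eLpNorm_congr_ae ?_)) hh)
  filter_upwards [hmem.coeFn_toLp] with x hx
  simp [hx]

theorem MeasureTheory.SimpleFunc.FinMeasSupp.memLp {B : Type*} [NormedAddCommGroup B]
    {h : SimpleFunc X B} (hh : h.FinMeasSupp μ) (q : ℝ≥0∞) : MemLp h q μ :=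
  SimpleFunc.memLp_of_finite_measure_preimage q
    fun _ hy => SimpleFunc.finMeasSupp_iff.1 hh _ hy

theorem IsLpExtension.unique [Fact (1 ≤ p)] (hp : p ≠ ∞) {T : Lp ℂ 2 μ →L[ℂ] Lp ℂ 2 μ}
    {S S' : Lp ℂ p μ →L[ℂ] Lp ℂ p μ} (h : IsLpExtension T S) (h' : IsLpExtension T S') :
    S = S' := by
  refine ContinuousLinearMap.ext_on (s := {g : Lp ℂ p μ | ∃ h : SimpleFunc X ℂ,
    h.FinMeasSupp μ ∧ g =ᵐ[μ] h}) ((dense_simpleFunc_Lp hp).mono Submodule.subset_span) ?_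
  rintro g ⟨k, hk, hg⟩
  have hf : (hk.memLp 2).toLp k =ᵐ[μ] g := (MemLp.coeFn_toLp _).trans hg.symm
  exact Lp.ext ((h _ _ hf).symm.trans (h' _ _ hf))

/-- Extend by continuity along the map `e` from `L² ∩ L^p` into `L^p`; its range is dense because it
contains the simple functions of finite measure support. -/
theorem exists_isLpExtension [Fact (1 ≤ p)] (hp : p ≠ ∞) {T : Lp ℂ 2 μ →L[ℂ] Lp ℂ 2 μ}
    (hT : ∀ f : Lp ℂ 2 μ, MemLp f p μ → eLpNorm (T f) p μ ≤ eLpNorm f p μ) :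
    ∃ S : Lp ℂ p μ →L[ℂ] Lp ℂ p μ, IsLpExtension T S ∧ ‖S‖ ≤ 1 := by
  have hmem : ∀ f : Lp ℂ 2 μ, MemLp f p μ → MemLp (T f) p μ := fun f hf =>
    ⟨Lp.aestronglyMeasurable _, (hT f hf).trans_lt hf.2⟩
  let D : Submodule ℂ (Lp ℂ 2 μ) :=
    { carrier := {f | MemLp f p μ}
      add_mem' := fun {f g} hf hg => (hf.add hg).ae_eq (Lp.coeFn_add f g).symm
      zero_mem' := (MemLp.zero' (p := p)).ae_eq (Lp.coeFn_zero ℂ 2 μ).symm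
      smul_mem' := fun c f hf => (hf.const_smul c).ae_eq (Lp.coeFn_smul c f).symm }
  let e : D →ₗ[ℂ] Lp ℂ p μ :=
    { toFun := fun f => MemLp.toLp f.1 f.2
      map_add' := fun f g => Lp.ext <| by
        filter_upwards [MemLp.coeFn_toLp (f + g).2, MemLp.coeFn_toLp f.2, MemLp.coeFn_toLp g.2,
          Lp.coeFn_add f.1 g.1, Lp.coeFn_add (MemLp.toLp f.1 f.2) (MemLp.toLp g.1 g.2)]
          with x h1 h2 h3 h4 h5
        rw [h1, h5, Pi.add_apply, h2, h3]
        exact h4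
      map_smul' := fun c f => Lp.ext <| by
        filter_upwards [MemLp.coeFn_toLp (c • f).2, MemLp.coeFn_toLp f.2,
          Lp.coeFn_smul c f.1, Lp.coeFn_smul c (MemLp.toLp f.1 f.2)] with x h1 h2 h3 h4
        rw [h1, RingHom.id_apply, h4, Pi.smul_apply, h2]
        exact h3 }
  let T' : D →ₗ[ℂ] Lp ℂ p μ := e.comp (T.toLinearMap.restrict (p := D) (q := D) hmem)
  have hdense : DenseRange e := by
    refine (dense_simpleFunc_Lp (B := ℂ) (μ := μ) hp).mono ?_
    rintro g ⟨k, hk, hg⟩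
    have hk2 : ⇑((hk.memLp 2).toLp k) =ᵐ[μ] k := MemLp.coeFn_toLp _
    have hmemp : MemLp ((hk.memLp 2).toLp k) p μ := (hk.memLp p).ae_eq hk2.symm
    exact ⟨⟨(hk.memLp 2).toLp k, hmemp⟩,
      Lp.ext ((MemLp.coeFn_toLp hmemp).trans (hk2.trans hg.symm))⟩
  have hbound : ∀ f, ‖T' f‖ ≤ 1 * ‖e f‖ := by
    intro f
    rw [one_mul]
    change ‖MemLp.toLp (T f.1) (hmem f.1 f.2)‖ ≤ ‖MemLp.toLp f.1 f.2‖
    rw [Lp.norm_toLp, Lp.norm_toLp]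
    exact ENNReal.toReal_mono f.2.2.ne (hT f.1 f.2)
  refine ⟨T'.extendOfNorm e, fun f g hfg => ?_,
    LinearMap.opNorm_extendOfNorm_le hdense zero_le_one hbound⟩
  have hf : MemLp f p μ := (Lp.memLp g).ae_eq hfg.symm
  have hg : g = e ⟨f, hf⟩ := Lp.ext (hfg.symm.trans (MemLp.coeFn_toLp hf).symm)
  rw [hg, LinearMap.extendOfNorm_eq hdense ⟨1, hbound⟩]
  exact (MemLp.coeFn_toLp (hmem f hf)).symm

theorem IsLpExtension.norm_le_one [Fact (1 ≤ p)] (hp : p ≠ ∞) {T : Lp ℂ 2 μ →L[ℂ] Lp ℂ 2 μ}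
    (hT : ∀ f : Lp ℂ 2 μ, MemLp f p μ → eLpNorm (T f) p μ ≤ eLpNorm f p μ)
    {S : Lp ℂ p μ →L[ℂ] Lp ℂ p μ} (h : IsLpExtension T S) : ‖S‖ ≤ 1 := by
  obtain ⟨R, hR, hn⟩ := exists_isLpExtension hp hT
  rwa [h.unique hp hR]

/-- On sets that are bounded in `L¹` and in `L^∞`, the `L^p` norm is controlled by the `L²` norm. -/
theorem exists_eLpNorm_le_mul_eLpNorm_two_rpow (hp : 1 < p) (hp' : p < ∞) {c : ℝ≥0∞}
    (hc : c ≠ ∞) :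
    ∃ K : ℝ≥0∞, K ≠ ∞ ∧ ∃ θ : ℝ, 0 < θ ∧ ∀ d : X → ℂ, AEStronglyMeasurable d μ →
      eLpNorm d 1 μ ≤ c → eLpNorm d ∞ μ ≤ c → eLpNorm d p μ ≤ K * eLpNorm d 2 μ ^ θ := by
  have hp0 : p ≠ 0 := (zero_lt_one.trans hp).ne'
  set q := p.toReal with hq
  have hq1 : 1 < q := by
    rw [hq, ← ENNReal.toReal_one]
    exact (ENNReal.toReal_lt_toReal ENNReal.one_ne_top hp'.ne).2 hp
  have hq0 : 0 < q := by linarith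
  have htwo : ∀ d : X → ℂ, ∫⁻ x, ‖d x‖ₑ ^ (2 : ℝ) ∂μ = eLpNorm d 2 μ ^ (2 : ℝ) := by
    intro d
    rw [eLpNorm_eq_lintegral_rpow_enorm_toReal two_ne_zero ENNReal.ofNat_ne_top,
      ← ENNReal.rpow_mul]
    simp
  -- For `q ≤ 2`, Hölder between `L¹` and `L²` with `q = (2 - q) + 2 (q - 1)`; for `q ≥ 2`, the
  -- factor `|d|^(q-2)` is pulled out in `L^∞`.
  rcases le_total q 2 with h2 | h2
  · refine ⟨(c ^ (2 - q)) ^ (1 / q), ENNReal.rpow_ne_top_of_nonneg (by positivity)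
      (ENNReal.rpow_ne_top_of_nonneg (by linarith) hc), 2 * (q - 1) * (1 / q), ?_, ?_⟩
    · have : 0 < q - 1 := by linarith
      positivity
    · intro d hd h1 _
      rw [eLpNorm_eq_lintegral_rpow_enorm_toReal hp0 hp'.ne, ← hq, ENNReal.rpow_mul,
        ENNReal.rpow_mul, ← htwo, ← ENNReal.mul_rpow_of_nonneg _ _ (by positivity)]
      refine ENNReal.rpow_le_rpow ?_ (by positivity)
      calc ∫⁻ x, ‖d x‖ₑ ^ q ∂μ = ∫⁻ x, ‖d x‖ₑ ^ (2 - q) * (‖d x‖ₑ ^ (2 : ℝ)) ^ (q - 1) ∂μ := by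
            refine lintegral_congr fun x => ?_
            rw [← ENNReal.rpow_mul, ← ENNReal.rpow_add_of_nonneg _ _ (by linarith) (by linarith)]
            congr 1; ring
        _ ≤ (∫⁻ x, ‖d x‖ₑ ∂μ) ^ (2 - q) * (∫⁻ x, ‖d x‖ₑ ^ (2 : ℝ) ∂μ) ^ (q - 1) :=
            ENNReal.lintegral_mul_norm_pow_le hd.enorm (hd.enorm.pow_const _) (by linarith)
              (by linarith) (by ring)
        _ ≤ _ := by
            rw [← eLpNorm_one_eq_lintegral_enorm]
            gcongr
  · refine ⟨(c ^ (q - 2)) ^ (1 / q), ENNReal.rpow_ne_top_of_nonneg (by positivity)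
      (ENNReal.rpow_ne_top_of_nonneg (by linarith) hc), 2 * (1 / q), by positivity, ?_⟩
    intro d hd _ hinf
    rw [eLpNorm_eq_lintegral_rpow_enorm_toReal hp0 hp'.ne, ← hq, ENNReal.rpow_mul, ← htwo,
      ← ENNReal.mul_rpow_of_nonneg _ _ (by positivity)]
    refine ENNReal.rpow_le_rpow ?_ (by positivity)
    rw [← lintegral_const_mul'' _ (hd.enorm.pow_const _)]
    refine lintegral_mono_ae ?_
    rw [eLpNorm_exponent_top] at hinf
    filter_upwards [ae_le_eLpNormEssSup (f := d) (μ := μ)] with x hx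
    calc ‖d x‖ₑ ^ q = ‖d x‖ₑ ^ (q - 2) * ‖d x‖ₑ ^ (2 : ℝ) := by
          rw [← ENNReal.rpow_add_of_nonneg _ _ (by linarith) (by norm_num)]
          congr 1; ring
      _ ≤ _ := by
          gcongr
          exact hx.trans hinf

/-- The extensions to `L^p` form a strongly continuous semigroup. -/
theorem isStronglyContinuousSemigroup_of_isLpExtension [Fact (1 ≤ p)] (hp : 1 < p) (hp' : p < ∞)
    {T : ℝ≥0 → Lp ℂ 2 μ →L[ℂ] Lp ℂ 2 μ} (hT : IsStronglyContinuousSemigroup T)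
    (hc : ContractionProperty T) {Tp : ℝ≥0 → Lp ℂ p μ →L[ℂ] Lp ℂ p μ}
    (hTp : ∀ t, IsLpExtension (T t) (Tp t)) : IsStronglyContinuousSemigroup Tp := by
  refine ⟨?_, fun s t => ?_, ?_⟩
  · refine (hTp 0).unique hp'.ne fun f g hfg => ?_
    rw [hT.zero]
    exact hfg
  · refine (hTp (s + t)).unique hp'.ne fun f g hfg => ?_
    rw [hT.add]
    exact hTp s _ _ (hTp t f g hfg)
  · refine continuous_orbit_of_dense (K := 1)
      (fun t => (hTp t).norm_le_one hp'.ne (hc t p hp.le)) (dense_simpleFunc_Lp hp'.ne) ?_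
    rintro g ⟨k, hk, hg⟩
    set f : Lp ℂ 2 μ := (hk.memLp 2).toLp k
    have hfk : f =ᵐ[μ] k := MemLp.coeFn_toLp _
    have hfg : f =ᵐ[μ] g := hfk.trans hg.symm
    have hf : ∀ q, MemLp f q μ := fun q => (hk.memLp q).ae_eq hfk.symm
    -- The simple function `f` lies in every `L^q`, so contractivity bounds `T_t f - T_s f` in `L¹`
    -- and `L^∞` uniformly in the times; continuity in `L²` then gives continuity in `L^p`.
    set c := (eLpNorm f 1 μ + eLpNorm f 1 μ) + (eLpNorm f ∞ μ + eLpNorm f ∞ μ) with hcdef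
    have hctop : c ≠ ∞ := by
      simp only [hcdef, ne_eq, ENNReal.add_eq_top, (hf 1).2.ne, (hf ∞).2.ne, or_self,
        not_false_eq_true]
    obtain ⟨K, hK, θ, hθ, hbound⟩ :=
      exists_eLpNorm_le_mul_eLpNorm_two_rpow (X := X) (μ := μ) hp hp' hctop
    have hdiff : ∀ s t q, 1 ≤ q →
        eLpNorm (⇑(T t f) - ⇑(T s f)) q μ ≤ eLpNorm f q μ + eLpNorm f q μ := fun s t q hq =>
      (eLpNorm_sub_le (Lp.aestronglyMeasurable _) (Lp.aestronglyMeasurable _) hq).trans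
        (add_le_add (hc t q hq f (hf q)) (hc s q hq f (hf q)))
    refine continuous_iff_continuousAt.2 fun s => ?_
    refine (Lp.tendsto_Lp_iff_tendsto_eLpNorm' _ _).2 ?_
    have h2 := (Lp.tendsto_Lp_iff_tendsto_eLpNorm' _ _).1 ((hT.continuous f).tendsto s)
    have h3 : Tendsto (fun t => K * eLpNorm (⇑(T t f) - ⇑(T s f)) 2 μ ^ θ) (𝓝 s) (𝓝 0) := by
      have := ENNReal.Tendsto.const_mul (a := K) (h2.ennrpow_const θ) (Or.inr hK)
      simpa [ENNReal.zero_rpow_of_pos hθ] using this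
    refine tendsto_of_tendsto_of_tendsto_of_le_of_le tendsto_const_nhds h3 (fun t => zero_le)
      fun t => ?_
    refine le_trans (le_of_eq (eLpNorm_congr_ae ?_)) (hbound _
      ((Lp.aestronglyMeasurable (T t f)).sub (Lp.aestronglyMeasurable (T s f)))
      ((hdiff s t 1 le_rfl).trans le_self_add) ((hdiff s t ∞ le_top).trans le_add_self))
    exact ((hTp t f g hfg).sub (hTp s f g hfg)).symm

end LpExtension

/-! ### Stability of finite suprema under `L^p` limits -/

section FiniteSup

variable {X B κ : Type*} [MeasurableSpace X] {μ : Measure X} {p : ℝ≥0∞} [Fact (1 ≤ p)]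
  [NormedAddCommGroup B]

/-- Pointwise, `|G_k| ≤ |H_k| + |G_k - H_k|`, and one difference is at most the sum of all. The
crude sum suffices, as it tends to 0 along limits of finite families. -/
theorem eLpNorm_sup_le_add (s : Finset κ) (G H : κ → Lp B p μ) :
    eLpNorm (fun x => s.sup fun k => ‖G k x‖ₑ) p μ ≤
      eLpNorm (fun x => s.sup fun k => ‖H k x‖ₑ) p μ + ∑ k ∈ s, ‖G k - H k‖ₑ := by
  have h1 : ∀ K : κ → Lp B p μ,
      AEStronglyMeasurable (fun x => s.sup fun k => ‖K k x‖ₑ) μ := fun K =>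
    (aemeasurable_finset_sup s fun k => (Lp.aestronglyMeasurable (K k)).enorm).aestronglyMeasurable
  have h2 : ∀ k ∈ s, AEStronglyMeasurable (fun x => ‖(G k - H k) x‖ₑ) μ := fun k _ =>
    (Lp.aestronglyMeasurable (G k - H k)).enorm.aestronglyMeasurable
  have hae : ∀ᵐ x ∂μ, ∀ k ∈ s, (G k - H k) x = G k x - H k x :=
    (ae_ball_iff s.countable_toSet).2 fun k _ => Lp.coeFn_sub (G k) (H k)
  calc eLpNorm (fun x => s.sup fun k => ‖G k x‖ₑ) p μ
      ≤ eLpNorm ((fun x => s.sup fun k => ‖H k x‖ₑ) + ∑ k ∈ s, fun x => ‖(G k - H k) x‖ₑ) p μ := by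
        refine eLpNorm_mono_enorm_ae ?_
        filter_upwards [hae] with x hx
        simp only [enorm_eq_self, Pi.add_apply, Finset.sum_apply]
        refine Finset.sup_le fun k hk => ?_
        calc ‖G k x‖ₑ = ‖H k x + (G k - H k) x‖ₑ := by rw [hx k hk]; congr 1; abel
          _ ≤ ‖H k x‖ₑ + ‖(G k - H k) x‖ₑ := enorm_add_le _ _
          _ ≤ _ := add_le_add (Finset.le_sup (f := fun k => ‖H k x‖ₑ) hk)
              (Finset.single_le_sum (f := fun k => ‖(G k - H k) x‖ₑ) (fun _ _ => zero_le) hk)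
    _ ≤ _ := (eLpNorm_add_le (h1 H) (Finset.aestronglyMeasurable_sum s h2) Fact.out).trans
        (add_le_add le_rfl (eLpNorm_sum_le h2 Fact.out))
    _ = _ := by simp_rw [eLpNorm_enorm, Lp.enorm_def]

theorem eLpNorm_sup_le_of_tendsto {ι : Type*} {l : Filter ι} [l.NeBot] {s : Finset κ}
    {G : ι → κ → Lp B p μ} {G' : κ → Lp B p μ} (hG : ∀ k ∈ s, Tendsto (G · k) l (𝓝 (G' k)))
    {c : ι → ℝ≥0∞} {c' : ℝ≥0∞} (hc : Tendsto c l (𝓝 c'))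
    (h : ∀ i, eLpNorm (fun x => s.sup fun k => ‖G i k x‖ₑ) p μ ≤ c i) :
    eLpNorm (fun x => s.sup fun k => ‖G' k x‖ₑ) p μ ≤ c' := by
  have hlim : Tendsto (fun i => c i + ∑ k ∈ s, ‖G' k - G i k‖ₑ) l (𝓝 (c' + ∑ k ∈ s, 0)) := by
    refine hc.add (tendsto_finsetSum s fun k hk => ?_)
    have h1 : Tendsto (fun i => G' k - G i k) l (𝓝 0) := by
      simpa using (hG k hk).const_sub (G' k)
    simpa using h1.enorm
  rw [Finset.sum_const_zero, add_zero] at hlim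
  exact ge_of_tendsto' hlim fun i =>
    (eLpNorm_sup_le_add s G' (G i)).trans (add_le_add (h i) le_rfl)

end FiniteSup

/-! ### Tensor product extensions -/

section Tensor

variable {X : Type*} [MeasurableSpace X] {μ : Measure X} {p : ℝ≥0∞}
  {B : Type*} [NormedAddCommGroup B] [NormedSpace ℂ B]

theorem coeFn_lpTensor (f : Lp ℂ p μ) (u : B) : lpTensor f u =ᵐ[μ] fun x => f x • u := by
  filter_upwards [ContinuousLinearMap.coeFn_compLp (ContinuousLinearMap.toSpanSingleton ℂ u) f]
    with x hx
  simpa [lpTensor] using hx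

/-- `lpTensor` as a linear map in the vector. -/
noncomputable def lpTensorLinear (f : Lp ℂ p μ) : B →ₗ[ℂ] Lp B p μ where
  toFun := lpTensor f
  map_add' u v := Lp.ext <| by
    filter_upwards [coeFn_lpTensor f (u + v), coeFn_lpTensor f u, coeFn_lpTensor f v,
      Lp.coeFn_add (lpTensor f u) (lpTensor f v)] with x h1 h2 h3 h4
    rw [h1, h4, Pi.add_apply, h2, h3, smul_add]
  map_smul' c u := Lp.ext <| by
    filter_upwards [coeFn_lpTensor f (c • u), coeFn_lpTensor f u,
      Lp.coeFn_smul c (lpTensor f u)] with x h1 h2 h4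
    rw [h1, RingHom.id_apply, h4, Pi.smul_apply, h2, smul_comm]

/-- The index set of indicator functions in `L^p`: measurable sets of finite measure. -/
abbrev FiniteMeasureSet (μ : Measure X) := {s : Set X // MeasurableSet s ∧ μ s ≠ ∞}

/-- The indicator function of a set of finite measure, in `L^p`. -/
noncomputable def FiniteMeasureSet.ind (p : ℝ≥0∞) (s : FiniteMeasureSet μ) : Lp ℂ p μ :=
  indicatorConstLp p s.2.1 s.2.2 1

/-- The finite sum `∑ u_s S(χ_s)`, as a linear function of the coefficients. -/
noncomputable def tensorSum (S : Lp ℂ p μ → Lp ℂ p μ) :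
    (FiniteMeasureSet μ →₀ B) →ₗ[ℂ] Lp B p μ :=
  Finsupp.lsum ℂ fun s => lpTensorLinear (S (s.ind p))

theorem tensorSum_apply (S : Lp ℂ p μ → Lp ℂ p μ) (z : FiniteMeasureSet μ →₀ B) :
    tensorSum S z = ∑ s : z.support, lpTensor (S (s.1.ind p)) (z s.1) := by
  rw [tensorSum, Finsupp.lsum_apply, Finsupp.sum, ← Finset.sum_coe_sort]
  rfl

variable [Fact (1 ≤ p)]

theorem denseRange_tensorSum (hp : p ≠ ∞) :
    DenseRange (tensorSum (B := B) (μ := μ) (p := p) id) := by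
  have key : ∀ f : Lp B p μ, f ∈ (LinearMap.range (tensorSum (B := B) (μ := μ) (p := p)
      id)).topologicalClosure := by
    intro f
    induction f using Lp.induction hp with
    | @indicatorConst c s hs hμs =>
      refine Submodule.le_topologicalClosure _ ⟨Finsupp.single ⟨_, hs, hμs.ne⟩ c, Lp.ext ?_⟩
      rw [tensorSum, Finsupp.lsum_single]
      filter_upwards [coeFn_lpTensor (FiniteMeasureSet.ind p ⟨_, hs, hμs.ne⟩) c,
        indicatorConstLp_coeFn (p := p) (μ := μ) (hs := hs) (hμs := hμs.ne) (c := (1 : ℂ)),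
        indicatorConstLp_coeFn (p := p) (μ := μ) (hs := hs) (hμs := hμs.ne) (c := c)]
        with x h1 h2 h3
      refine h1.trans ?_
      rw [Lp.simpleFunc.coe_indicatorConst, h3, FiniteMeasureSet.ind, h2]
      by_cases hx : x ∈ s <;> simp [hx]
    | add hf hg hd h1 h2 => exact Submodule.add_mem _ h1 h2
    | isClosed => exact Submodule.isClosed_topologicalClosure _
  intro f
  exact key f

theorem isTensorExtension_iff {S : Lp ℂ p μ → Lp ℂ p μ} {R : Lp B p μ →L[ℂ] Lp B p μ} :
    IsTensorExtension S R ↔ ∀ f u, R (lpTensor f u) = lpTensor (S f) u := by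
  refine ⟨fun h f u => ?_, fun h n u f => ?_⟩
  · simpa using h 1 (fun _ => u) fun _ => f
  · rw [map_sum]
    exact Finset.sum_congr rfl fun k _ => h _ _

theorem IsTensorExtension.apply_tensorSum {S : Lp ℂ p μ → Lp ℂ p μ}
    {R : Lp B p μ →L[ℂ] Lp B p μ} (h : IsTensorExtension S R) (z : FiniteMeasureSet μ →₀ B) :
    R (tensorSum id z) = tensorSum S z := by
  rw [tensorSum_apply, tensorSum_apply, map_sum]
  exact Finset.sum_congr rfl fun s _ => isTensorExtension_iff.1 h _ _

theorem IsTensorExtension.unique (hp : p ≠ ∞) {S : Lp ℂ p μ → Lp ℂ p μ}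
    {R R' : Lp B p μ →L[ℂ] Lp B p μ} (h : IsTensorExtension S R) (h' : IsTensorExtension S R') :
    R = R' := by
  refine ContinuousLinearMap.ext fun F => ?_
  refine congrFun ((denseRange_tensorSum hp).equalizer R.continuous R'.continuous
    (funext fun z => ?_)) F
  exact (h.apply_tensorSum z).trans (h'.apply_tensorSum z).symm

/-- Formal sums of vectors indexed by sets make both tensor sums linear without any choice of
representation. The bound `hK` shows that the second depends only on the value of the first, so it
extends by density. -/
theorem exists_isTensorExtension [CompleteSpace B] (hp : p ≠ ∞) (S : Lp ℂ p μ →L[ℂ] Lp ℂ p μ)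
    {K : ℝ} (hK0 : 0 ≤ K)
    (hK : ∀ z : FiniteMeasureSet μ →₀ B, ‖tensorSum S z‖ ≤ K * ‖tensorSum (p := p) id z‖) :
    ∃ R : Lp B p μ →L[ℂ] Lp B p μ, IsTensorExtension S R ∧ ‖R‖ ≤ K := by
  have hdense := denseRange_tensorSum (B := B) (μ := μ) (p := p) hp
  refine ⟨(tensorSum S).extendOfNorm (tensorSum (B := B) (μ := μ) (p := p) id),
    isTensorExtension_iff.2 fun f u => ?_,
    LinearMap.opNorm_extendOfNorm_le hdense hK0 hK⟩
  set R := (tensorSum (B := B) S).extendOfNorm (tensorSum (B := B) (μ := μ) (p := p) id)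
  set Λ : Lp ℂ p μ →L[ℂ] Lp B p μ := (ContinuousLinearMap.toSpanSingleton ℂ u).compLpL p μ
  -- So far `R` is known only on tensors of indicators. Both sides are continuous in the scalar
  -- function, so it is enough to compare them on scalar combinations of indicators, the case `B =
  -- ℂ` of the density statement.
  suffices h : R.comp Λ = Λ.comp S from congrArg (fun A => A f) h
  refine ContinuousLinearMap.ext fun g => ?_
  refine congrFun ((denseRange_tensorSum (B := ℂ) hp).equalizer
    (R.comp Λ).continuous (Λ.comp S).continuous (funext fun z => ?_)) g
  change R.comp Λ (tensorSum id z) = Λ.comp S (tensorSum id z)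
  rw [tensorSum_apply, map_sum, map_sum]
  refine Finset.sum_congr rfl fun s _ => ?_
  have hz : lpTensor (id (s.1.ind p)) (z s.1) = z s.1 • s.1.ind p := Lp.ext <| by
    filter_upwards [coeFn_lpTensor (s.1.ind p) (z s.1), Lp.coeFn_smul (z s.1) (s.1.ind p)]
      with x h1 h2
    refine h1.trans ?_
    rw [h2, Pi.smul_apply, smul_eq_mul, smul_eq_mul, mul_comm]
  rw [hz, map_smul, map_smul]
  congr 1
  have h1 := LinearMap.extendOfNorm_eq hdense ⟨K, hK⟩ (Finsupp.single s.1 u)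
  rw [tensorSum, tensorSum, Finsupp.lsum_single, Finsupp.lsum_single] at h1
  exact h1

end Tensor

/-! ### The discrete maximal inequality on `L^p(X, B)` -/

section Maximal

variable {X : Type*} [MeasurableSpace X] {μ : Measure X} {p : ℝ≥0∞} [Fact (1 ≤ p)]
  {B : Type*} [NormedAddCommGroup B] [NormedSpace ℂ B]

theorem IsLpExtension.pow {T : Lp ℂ 2 μ →L[ℂ] Lp ℂ 2 μ} {S : Lp ℂ p μ →L[ℂ] Lp ℂ p μ}
    (h : IsLpExtension T S) (k : ℕ) : IsLpExtension (T ^ k) (S ^ k) := by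
  induction k with
  | zero => exact fun f g hfg => hfg
  | succ k ih =>
    intro f g hfg
    rw [pow_succ', pow_succ', mul_apply_eq_comp, mul_apply_eq_comp]
    exact h _ _ (ih f g hfg)

/-- The constant `2 (p / (p - 1))^(1/p)` of the maximal inequality. -/
noncomputable def maximalConst (p : ℝ≥0∞) : ℝ :=
  2 * (p.toReal / (p.toReal - 1)) ^ (1 / p.toReal)

theorem one_lt_toReal {p : ℝ≥0∞} (hp : 1 < p) (hp' : p < ∞) : 1 < p.toReal := by
  rw [← ENNReal.toReal_one]
  exact (ENNReal.toReal_lt_toReal ENNReal.one_ne_top hp'.ne).2 hp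

theorem maximalConst_nonneg {p : ℝ≥0∞} (hp : 1 < p) (hp' : p < ∞) : 0 ≤ maximalConst p := by
  have h1 := one_lt_toReal hp hp'
  have h2 : 0 < p.toReal - 1 := by linarith
  rw [maximalConst]
  positivity

theorem rpow_eq_maximalConst {p : ℝ≥0∞} (hp : 1 < p) (hp' : p < ∞) :
    ENNReal.ofReal (2 ^ p.toReal * (p.toReal / (p.toReal - 1))) ^ (1 / p.toReal) =
      ENNReal.ofReal (maximalConst p) := by
  have h1 := one_lt_toReal hp hp'
  have h2 : 0 < p.toReal - 1 := by linarith
  have h3 : 0 < p.toReal := by linarith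
  rw [ENNReal.ofReal_rpow_of_nonneg (by positivity) (by positivity),
    Real.mul_rpow (by positivity) (by positivity), ← Real.rpow_mul zero_le_two,
    mul_one_div_cancel h3.ne', Real.rpow_one, maximalConst]

/-- Discrete maximal ergodic inequality on finite sums of tensors of indicator functions. -/
theorem eLpNorm_sup_average_tensorSum_le (hp : 1 < p) (hp' : p < ∞)
    {T : Lp ℂ 2 μ →L[ℂ] Lp ℂ 2 μ}
    (hT : ∀ q : ℝ≥0∞, 1 ≤ q → ∀ f : Lp ℂ 2 μ, MemLp f q μ → eLpNorm (T f) q μ ≤ eLpNorm f q μ)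
    {S : Lp ℂ p μ →L[ℂ] Lp ℂ p μ} (hS : IsLpExtension T S) (z : FiniteMeasureSet μ →₀ B) (N : ℕ) :
    eLpNorm (fun x => (Finset.range (N + 1)).sup fun n =>
        ‖(((n : ℝ) + 1)⁻¹ • ∑ k ∈ Finset.range (n + 1), tensorSum ⇑(S ^ k) z : Lp B p μ) x‖ₑ) p μ ≤
      ENNReal.ofReal (maximalConst p) * eLpNorm (tensorSum (p := p) id z) p μ := by
  have hp0 : p ≠ 0 := (zero_lt_one.trans hp).ne'
  have hq1 := one_lt_toReal hp hp'
  have hT1 : ‖T‖ ≤ 1 := by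
    refine T.opNorm_le_bound zero_le_one fun f => ?_
    rw [one_mul, Lp.norm_def, Lp.norm_def]
    exact ENNReal.toReal_mono (Lp.eLpNorm_ne_top f) (hT 2 one_le_two f (Lp.memLp f))
  set h : z.support → SimpleFunc X ℂ := fun s =>
    SimpleFunc.piecewise s.1.1 s.1.2.1 (SimpleFunc.const X 1) (SimpleFunc.const X 0) with hh
  have hcoe : ∀ s, ⇑(h s) = s.1.1.indicator fun _ => (1 : ℂ) := by
    intro s
    ext x
    by_cases hx : x ∈ s.1.1 <;> simp [hh, Set.piecewise, hx]
  have hind : ∀ (q : ℝ≥0∞) s, s.1.ind q =ᵐ[μ] h s := fun q s => by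
    rw [hcoe]
    exact indicatorConstLp_coeFn
  have hmem : ∀ s, MemLp (h s) 2 μ := fun s => by
    rw [hcoe]
    exact memLp_indicator_const 2 s.1.2.1 1 (Or.inr s.1.2.2)
  have main := lintegral_sup_average_simpleFunc_le hT1 (hT 1 le_rfl) (hT ∞ le_top) h hmem
    (fun s => hind 2 s) (fun s => z s.1) N hq1
  have hae : ∀ᵐ x ∂μ, ∀ k : ℕ, tensorSum (p := p) ⇑(S ^ k) z x =
      ∑ s : z.support, ((T ^ k) (s.1.ind 2) : X → ℂ) x • z s.1 := by
    refine ae_all_iff.2 fun k => ?_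
    rw [tensorSum_apply]
    have h1 : ∀ᵐ x ∂μ, ∀ s : z.support, lpTensor ((S ^ k) (s.1.ind p)) (z s.1) x =
        ((T ^ k) (s.1.ind 2) : X → ℂ) x • z s.1 := by
      refine ae_all_iff.2 fun s => ?_
      filter_upwards [coeFn_lpTensor ((S ^ k) (s.1.ind p)) (z s.1),
        hS.pow k _ _ ((hind 2 s).trans (hind p s).symm)] with x h2 h3
      rw [h2, h3]
    filter_upwards [coeFn_finsetSum_Lp Finset.univ fun s : z.support =>
      lpTensor ((S ^ k) (s.1.ind p)) (z s.1), h1] with x h2 h3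
    rw [h2]
    exact Finset.sum_congr rfl fun s _ => h3 s
  have hae' : ∀ᵐ x ∂μ, ∀ n : ℕ,
      (((n : ℝ) + 1)⁻¹ • ∑ k ∈ Finset.range (n + 1), tensorSum ⇑(S ^ k) z : Lp B p μ) x =
        ((n : ℝ) + 1)⁻¹ • ∑ k ∈ Finset.range (n + 1),
          ∑ s : z.support, ((T ^ k) (s.1.ind 2) : X → ℂ) x • z s.1 := by
    refine ae_all_iff.2 fun n => ?_
    filter_upwards [hae, coeFn_finsetSum_Lp (Finset.range (n + 1)) fun k => tensorSum ⇑(S ^ k) z,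
      Lp.coeFn_smul (((n : ℝ) + 1)⁻¹) (∑ k ∈ Finset.range (n + 1), tensorSum ⇑(S ^ k) z)]
      with x h1 h2 h3
    rw [h3, Pi.smul_apply, h2]
    simp_rw [h1]
  rw [eLpNorm_eq_lintegral_rpow_enorm_toReal hp0 hp'.ne,
    eLpNorm_eq_lintegral_rpow_enorm_toReal hp0 hp'.ne, ← rpow_eq_maximalConst hp hp',
    ← ENNReal.mul_rpow_of_nonneg _ _ (by positivity)]
  refine ENNReal.rpow_le_rpow ?_ (by positivity)
  refine le_trans (le_of_eq (lintegral_congr_ae ?_)) (main.trans (le_of_eq ?_))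
  · filter_upwards [hae'] with x hx
    simp_rw [enorm_eq_self, hx]
  · congr 1
    refine lintegral_congr_ae ?_
    filter_upwards [hae] with x hx
    have := hx 0
    simp only [pow_zero] at this
    rw [show tensorSum (p := p) id z x = tensorSum (⇑(1 : Lp ℂ p μ →L[ℂ] Lp ℂ p μ)) z x from rfl,
      this]
    rfl

/-- The case `N = 1` of the maximal inequality bounds `(F + G) / 2`, and subtracting `F` bounds `G`.
The constant is crude, but it depends only on `p`, so it is uniform over a semigroup. -/
theorem norm_tensorSum_le (hp : 1 < p) (hp' : p < ∞) {T : Lp ℂ 2 μ →L[ℂ] Lp ℂ 2 μ}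
    (hT : ∀ q : ℝ≥0∞, 1 ≤ q → ∀ f : Lp ℂ 2 μ, MemLp f q μ → eLpNorm (T f) q μ ≤ eLpNorm f q μ)
    {S : Lp ℂ p μ →L[ℂ] Lp ℂ p μ} (hS : IsLpExtension T S) (z : FiniteMeasureSet μ →₀ B) :
    ‖tensorSum S z‖ ≤ (2 * maximalConst p + 1) * ‖tensorSum (p := p) id z‖ := by
  set F := tensorSum (p := p) id z with hF
  set G := tensorSum S z with hG
  have h1 : ‖((1 : ℝ) + 1)⁻¹ • (F + G)‖ ≤ maximalConst p * ‖F‖ := by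
    have h2 := eLpNorm_sup_average_tensorSum_le hp hp' hT hS z 1
    have h3 : eLpNorm (((1 : ℝ) + 1)⁻¹ • (F + G) : Lp B p μ) p μ ≤
        ENNReal.ofReal (maximalConst p) * eLpNorm F p μ := by
      refine le_trans (eLpNorm_mono_enorm_ae (Eventually.of_forall fun x => ?_)) h2
      rw [enorm_eq_self]
      refine le_trans (le_of_eq ?_) (Finset.le_sup (f := fun n : ℕ => ‖(((n : ℝ) + 1)⁻¹ •
        ∑ k ∈ Finset.range (n + 1), tensorSum ⇑(S ^ k) z : Lp B p μ) x‖ₑ)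
        (Finset.mem_range.2 (show 1 < 1 + 1 by norm_num)))
      rw [Finset.sum_range_succ, Finset.sum_range_one, pow_zero, pow_one, Nat.cast_one]
      rfl
    rw [Lp.norm_def, Lp.norm_def, ← ENNReal.toReal_ofReal (maximalConst_nonneg hp hp'),
      ← ENNReal.toReal_mul]
    exact ENNReal.toReal_mono (ENNReal.mul_ne_top ENNReal.ofReal_ne_top (Lp.eLpNorm_ne_top F)) h3
  rw [norm_smul, Real.norm_of_nonneg (by norm_num)] at h1
  have h4 : ‖G‖ ≤ ‖F + G‖ + ‖F‖ := by
    calc ‖G‖ = ‖(F + G) - F‖ := by rw [add_sub_cancel_left]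
      _ ≤ _ := norm_sub_le _ _
  linarith

theorem IsTensorExtension.pow {S : Lp ℂ p μ →L[ℂ] Lp ℂ p μ} {R : Lp B p μ →L[ℂ] Lp B p μ}
    (h : IsTensorExtension S R) (k : ℕ) : IsTensorExtension (S ^ k : _ →L[ℂ] _) (R ^ k) := by
  rw [isTensorExtension_iff] at h ⊢
  induction k with
  | zero => exact fun f u => rfl
  | succ k ih =>
    intro f u
    rw [pow_succ', pow_succ', mul_apply_eq_comp, mul_apply_eq_comp, ih, h]

/-- Discrete maximal ergodic inequality on `L^p(X, B)`. -/
theorem eLpNorm_sup_average_le (hp : 1 < p) (hp' : p < ∞) {T : Lp ℂ 2 μ →L[ℂ] Lp ℂ 2 μ}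
    (hT : ∀ q : ℝ≥0∞, 1 ≤ q → ∀ f : Lp ℂ 2 μ, MemLp f q μ → eLpNorm (T f) q μ ≤ eLpNorm f q μ)
    {S : Lp ℂ p μ →L[ℂ] Lp ℂ p μ} (hS : IsLpExtension T S) {R : Lp B p μ →L[ℂ] Lp B p μ}
    (hR : IsTensorExtension S R) (F : Lp B p μ) (N : ℕ) :
    eLpNorm (fun x => (Finset.range (N + 1)).sup fun n =>
        ‖(((n : ℝ) + 1)⁻¹ • ∑ k ∈ Finset.range (n + 1), (R ^ k) F : Lp B p μ) x‖ₑ) p μ ≤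
      ENNReal.ofReal (maximalConst p) * eLpNorm F p μ := by
  obtain ⟨G, hG, hlim⟩ := mem_closure_iff_seq_limit.1 (denseRange_tensorSum hp'.ne F)
  have hsum : Tendsto (fun i => ENNReal.ofReal (maximalConst p) * eLpNorm (G i) p μ) atTop
      (𝓝 (ENNReal.ofReal (maximalConst p) * eLpNorm F p μ)) := by
    simp_rw [← Lp.enorm_def]
    exact ENNReal.Tendsto.const_mul hlim.enorm (Or.inr ENNReal.ofReal_ne_top)
  refine eLpNorm_sup_le_of_tendsto (l := atTop) (G := fun i (n : ℕ) =>
    ((n : ℝ) + 1)⁻¹ • ∑ k ∈ Finset.range (n + 1), (R ^ k) (G i)) (fun n _ => ?_) hsum fun i => ?_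
  · exact (tendsto_finsetSum _ fun k _ => ((R ^ k).continuous.tendsto F).comp hlim).const_smul _
  · obtain ⟨z, hz⟩ := hG i
    rw [← hz]
    simp_rw [(hR.pow _).apply_tensorSum]
    exact eLpNorm_sup_average_tensorSum_le hp hp' hT hS z N

end Maximal

/-! ### Passage to continuous time -/

theorem exists_common_denominator (s : Finset ℚ≥0) :
    ∃ D : ℕ, 0 < D ∧ ∀ q ∈ s, 0 < q → ∃ a : ℕ, 0 < a ∧ (q : ℝ) * D = a := by
  refine ⟨∏ q ∈ s, q.den, Finset.prod_pos fun q _ => q.den_pos, fun q hq hq0 => ?_⟩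
  obtain ⟨e, he⟩ := Finset.dvd_prod_of_mem NNRat.den hq
  have hD : 0 < ∏ q ∈ s, q.den := Finset.prod_pos fun q _ => q.den_pos
  refine ⟨q.num * e, Nat.mul_pos (NNRat.num_pos.2 hq0) (Nat.pos_of_ne_zero ?_), ?_⟩
  · rintro rfl
    omega
  · have h : (q : ℝ) * q.den = q.num := by exact_mod_cast NNRat.mul_den_eq_num q
    rw [he]
    push_cast
    rw [← mul_assoc, h]

section

variable {X : Type*} [MeasurableSpace X] {μ : Measure X} {p : ℝ≥0∞} [Fact (1 ≤ p)]
  {B : Type*} [NormedAddCommGroup B] [NormedSpace ℂ B]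
  {T : ℝ≥0 → Lp ℂ 2 μ →L[ℂ] Lp ℂ 2 μ} {Tp : ℝ≥0 → Lp ℂ p μ →L[ℂ] Lp ℂ p μ}
  {TB : ℝ≥0 → Lp B p μ →L[ℂ] Lp B p μ}

theorem norm_tensorExtension_le [CompleteSpace B] (hp : 1 < p) (hp' : p < ∞)
    (hc : ContractionProperty T) (hTp : ∀ t, IsLpExtension (T t) (Tp t))
    (hTB : ∀ t, IsTensorExtension (Tp t) (TB t)) (t : ℝ≥0) :
    ‖TB t‖ ≤ 2 * maximalConst p + 1 := by
  have := maximalConst_nonneg hp hp'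
  obtain ⟨R, hR, hn⟩ := exists_isTensorExtension (B := B) hp'.ne (Tp t) (by positivity)
    (norm_tensorSum_le hp hp' (hc t) (hTp t))
  rwa [(hTB t).unique hp'.ne hR]

theorem isStronglyContinuousSemigroup_of_isTensorExtension [CompleteSpace B] (hp : 1 < p)
    (hp' : p < ∞) (hc : ContractionProperty T) (hTp : ∀ t, IsLpExtension (T t) (Tp t))
    (hsg : IsStronglyContinuousSemigroup Tp) (hTB : ∀ t, IsTensorExtension (Tp t) (TB t)) :
    IsStronglyContinuousSemigroup TB := by
  refine ⟨?_, fun s t => ?_, ?_⟩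
  · refine (hTB 0).unique hp'.ne (isTensorExtension_iff.2 fun f u => ?_)
    rw [hsg.zero]
    rfl
  · refine (hTB (s + t)).unique hp'.ne (isTensorExtension_iff.2 fun f u => ?_)
    rw [hsg.add, ContinuousLinearMap.comp_apply, isTensorExtension_iff.1 (hTB t),
      isTensorExtension_iff.1 (hTB s)]
    rfl
  · refine continuous_orbit_of_dense (norm_tensorExtension_le hp hp' hc hTp hTB)
      (denseRange_tensorSum hp'.ne) ?_
    rintro _ ⟨z, rfl⟩
    simp_rw [(hTB _).apply_tensorSum, tensorSum_apply]
    refine continuous_finsetSum _ fun s _ => ?_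
    exact ((ContinuousLinearMap.toSpanSingleton ℂ (z s.1)).compLpL p μ).continuous.comp
      (hsg.continuous _)

/-- The ergodic averages of the tensor product extensions are tensor product extensions of the
ergodic averages. -/
theorem ergodicAverage_lpTensor [CompleteSpace B] (hsg : IsStronglyContinuousSemigroup Tp)
    (hTB : ∀ t, IsTensorExtension (Tp t) (TB t)) (t : ℝ≥0) (f : Lp ℂ p μ) (u : B) :
    ergodicAverage TB t (lpTensor f u) = lpTensor (ergodicAverage Tp t f) u := by
  set Λ : Lp ℂ p μ →L[ℂ] Lp B p μ := (ContinuousLinearMap.toSpanSingleton ℂ u).compLpL p μ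
  change _ = Λ (ergodicAverage Tp t f)
  rw [ergodicAverage, ergodicAverage, ContinuousLinearMap.map_smul_of_tower]
  congr 1
  exact (intervalIntegral.integral_congr fun s _ => isTensorExtension_iff.1 (hTB _) f u).trans
    (Λ.intervalIntegral_comp_comm ((hsg.continuous_toNNReal f).intervalIntegrable _ _))

/-- Maximal inequality for finitely many ergodic averages at rational times. -/
theorem eLpNorm_sup_ergodicAverage_le [CompleteSpace B] (hp : 1 < p) (hp' : p < ∞)
    (hc : ContractionProperty T) (hTp : ∀ t, IsLpExtension (T t) (Tp t))
    (hTB : ∀ t, IsTensorExtension (Tp t) (TB t)) (hsg : IsStronglyContinuousSemigroup TB)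
    (F : Lp B p μ) (s : Finset {q : ℚ≥0 // 0 < q}) :
    eLpNorm (fun x => s.sup fun q => ‖ergodicAverage TB (q.1 : ℝ≥0) F x‖ₑ) p μ ≤
      ENNReal.ofReal (maximalConst p) * eLpNorm F p μ := by
  obtain ⟨D, hD, ha⟩ := exists_common_denominator (s.map ⟨Subtype.val, Subtype.val_injective⟩)
  have ha' : ∀ q ∈ s, ∃ a : ℕ, 0 < a ∧ (q.1 : ℝ) * D = a := fun q hq =>
    ha q.1 (Finset.mem_map.2 ⟨q, hq, rfl⟩) q.2
  choose! a ha0 haD using ha'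
  -- With `q = a_q / D` these choices give `(n_q + 1) δ_m = q` for every `q` in `s`. The left
  -- Riemann sums at all these times are thus averages of powers of the single operator `TB (δ m)`;
  -- the `- 1` matches sums over `n + 1` terms.
  set δ : ℕ → ℝ≥0 := fun m => 1 / (D * (m + 1)) with hδ
  set n : {q : ℚ≥0 // 0 < q} → ℕ → ℕ := fun q m => a q * (m + 1) - 1 with hn
  have hn1 : ∀ q ∈ s, ∀ m, n q m + 1 = a q * (m + 1) := fun q hq m =>
    Nat.sub_add_cancel (Nat.mul_pos (ha0 q hq) m.succ_pos)
  have hDr : (0 : ℝ) < D := by exact_mod_cast hD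
  refine eLpNorm_sup_le_of_tendsto (l := atTop) (G := fun m q => ((n q m : ℝ) + 1)⁻¹ •
    ∑ k ∈ Finset.range (n q m + 1), (TB (δ m) ^ k) F) (fun q hq => ?_)
    tendsto_const_nhds fun m => ?_
  · have hq0 : (0 : ℝ) < q.1 := by exact_mod_cast q.2
    have hlim := tendsto_riemannSum (hsg.continuous_toNNReal F) hq0
    have hnlim : Tendsto (n q) atTop atTop := by
      refine tendsto_atTop_mono (fun m => ?_) tendsto_id
      have h1 := hn1 q hq m
      have h2 := Nat.le_mul_of_pos_left (m + 1) (ha0 q hq)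
      simp only [id]
      omega
    refine (hlim.comp hnlim).congr fun m => ?_
    simp only [Function.comp_apply]
    congr 1
    refine Finset.sum_congr rfl fun k _ => ?_
    rw [hsg.pow_eq]
    congr 2
    have h1 : ((n q m : ℝ) + 1) = a q * (m + 1) := by exact_mod_cast hn1 q hq m
    have ha1 : (0 : ℝ) < a q := by exact_mod_cast ha0 q hq
    have h2 : (q.1 : ℝ) / ((n q m : ℝ) + 1) = (δ m : ℝ) := by
      rw [h1, hδ]
      push_cast
      rw [← haD q hq] at ha1 ⊢
      field_simp
    rw [h2, ← NNReal.coe_natCast, ← NNReal.coe_mul, Real.toNNReal_coe]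
  · refine le_trans (eLpNorm_mono_enorm_ae (Eventually.of_forall fun x => ?_))
      (eLpNorm_sup_average_le hp hp' (hc (δ m)) (hTp (δ m)) (hTB (δ m)) F (s.sup fun q => n q m))
    simp only [enorm_eq_self]
    refine Finset.sup_le fun q hq => ?_
    exact Finset.le_sup (f := fun j : ℕ => ‖(((j : ℝ) + 1)⁻¹ • ∑ k ∈ Finset.range (j + 1),
      (TB (δ m) ^ k) F : Lp B p μ) x‖ₑ) (Finset.mem_range.2
        (Nat.lt_succ_of_le (Finset.le_sup (f := fun q => n q m) hq)))

/-- Monotone convergence along the directed family of finite subsets, after taking the power `p`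
inside the supremum. -/
theorem eLpNorm_iSup_le_of_finset {p : ℝ≥0∞} {κ : Type*} [Countable κ] (hp : 1 < p) (hp' : p < ∞)
    {g : κ → X → ℝ≥0∞} (hg : ∀ k, AEMeasurable (g k) μ) {c : ℝ≥0∞}
    (h : ∀ s : Finset κ, eLpNorm (fun x => s.sup fun k => g k x) p μ ≤ c) :
    eLpNorm (fun x => ⨆ k, g k x) p μ ≤ c := by
  classical
  have hp0 : p ≠ 0 := (zero_lt_one.trans hp).ne'
  have hq : 0 < p.toReal := zero_lt_one.trans (one_lt_toReal hp hp')
  have hsup : ∀ x, (⨆ k, g k x) ^ p.toReal =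
      ⨆ s : Finset κ, (s.sup fun k => g k x) ^ p.toReal := by
    intro x
    rw [iSup_eq_iSup_finset]
    simp_rw [← Finset.sup_eq_iSup]
    exact (ENNReal.orderIsoRpow p.toReal hq).map_iSup _
  rw [eLpNorm_eq_lintegral_rpow_enorm_toReal hp0 hp'.ne]
  simp_rw [enorm_eq_self, hsup]
  rw [lintegral_iSup_directed (fun s => (aemeasurable_finset_sup s hg).pow_const _)]
  · rw [one_div, ENNReal.rpow_inv_le_iff hq]
    refine iSup_le fun s => ?_
    rw [← ENNReal.rpow_inv_le_iff hq, ← one_div]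
    simpa [eLpNorm_eq_lintegral_rpow_enorm_toReal hp0 hp'.ne] using h s
  · intro s t
    refine ⟨s ∪ t, fun x => ?_, fun x => ?_⟩
    · exact ENNReal.rpow_le_rpow (Finset.sup_mono Finset.subset_union_left) hq.le
    · exact ENNReal.rpow_le_rpow (Finset.sup_mono Finset.subset_union_right) hq.le

/-- For a family in `L^p` that is continuous in the time parameter, the supremum over the positive
rational times is the almost everywhere supremum over all positive times. -/
theorem isAESup_iSup_rat {B : Type*} [NormedAddCommGroup B] {A : ℝ≥0 → Lp B p μ}
    (hA : ∀ t, 0 < t → ContinuousAt A t) :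
    IsAESup μ (fun (t : Set.Ioi (0 : ℝ≥0)) (x : X) => ‖A t x‖ₑ)
      fun x => ⨆ (q : ℚ≥0) (_ : 0 < q), ‖A (q : ℝ≥0) x‖ₑ := by
  refine ⟨?_, fun t => ?_, fun N _ hN => ?_⟩
  · exact AEMeasurable.iSup fun q => AEMeasurable.iSup fun _ => (Lp.aestronglyMeasurable _).enorm
  · have ht : (0 : ℝ≥0) < t := t.2
    -- Rationals are taken from above, which keeps them positive. A subsequence of the corresponding
    -- functions converges almost everywhere, so the rational supremum dominates the limit.
    have hseq : ∀ n : ℕ, ∃ q : ℚ≥0, (t : ℝ≥0) < q ∧ (q : ℝ≥0) < t + 1 / ((n : ℝ≥0) + 1) := by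
      intro n
      have hlt : ((t : ℝ≥0) : ℝ) < t + 1 / ((n : ℝ) + 1) := by
        have : (0 : ℝ) < 1 / ((n : ℝ) + 1) := by positivity
        linarith
      obtain ⟨r, hr1, hr2⟩ := exists_rat_btwn hlt
      have hr0 : 0 ≤ r := by
        have : (0 : ℝ) < r := lt_of_le_of_lt (NNReal.coe_nonneg _) hr1
        exact_mod_cast this.le
      lift r to ℚ≥0 using hr0
      refine ⟨r, ?_, ?_⟩
      · exact_mod_cast hr1
      · exact_mod_cast hr2
    choose q hq1 hq2 using hseq
    have hq : Tendsto (fun n => (q n : ℝ≥0)) atTop (𝓝 (t : ℝ≥0)) := by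
      have hz : Tendsto (fun n : ℕ => (t : ℝ≥0) + 1 / ((n : ℝ≥0) + 1)) atTop
          (𝓝 ((t : ℝ≥0) + 0)) :=
        tendsto_const_nhds.add tendsto_one_div_add_atTop_nhds_zero_nat
      rw [add_zero] at hz
      exact tendsto_of_tendsto_of_tendsto_of_le_of_le tendsto_const_nhds hz
        (fun n => (hq1 n).le) fun n => (hq2 n).le
    obtain ⟨φ, -, hφ⟩ := (tendstoInMeasure_of_tendsto_Lp
      ((hA t ht).tendsto.comp hq)).exists_seq_tendsto_ae
    filter_upwards [hφ] with x hx
    refine le_of_tendsto' hx.enorm fun n => ?_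
    refine le_iSup₂_of_le (q (φ n)) ?_ le_rfl
    exact_mod_cast ht.trans (hq1 (φ n))
  · have : ∀ᵐ x ∂μ, ∀ q : ℚ≥0, 0 < q → ‖A (q : ℝ≥0) x‖ₑ ≤ N x := by
      refine ae_all_iff.2 fun q => ?_
      by_cases hq : 0 < q
      · filter_upwards [hN ⟨(q : ℝ≥0), Set.mem_Ioi.2 (by exact_mod_cast hq)⟩] with x hx _
        exact hx
      · exact Eventually.of_forall fun x h => absurd h hq
    filter_upwards [this] with x hx
    exact iSup₂_le hx

end

/-! ### The maximal ergodic theorem -/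

theorem mainTheorem3 {X : Type*} [MeasurableSpace X] (μ : Measure X) [SigmaFinite μ]
    {B : Type*} [NormedAddCommGroup B] [NormedSpace ℂ B] [CompleteSpace B]
    (T : ℝ≥0 → Lp ℂ 2 μ →L[ℂ] Lp ℂ 2 μ)
    (hT : IsStronglyContinuousSemigroup T) (hc : ContractionProperty T)
    (p : ℝ≥0∞) [Fact (1 ≤ p)] (hp : 1 < p) (hp' : p < ∞) :
    -- each `T_t` has a unique extension to `L^p(X)`
    (∀ t, ∃! S : Lp ℂ p μ →L[ℂ] Lp ℂ p μ, IsLpExtension (T t) S) ∧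
    ∀ Tp : ℝ≥0 → Lp ℂ p μ →L[ℂ] Lp ℂ p μ, (∀ t, IsLpExtension (T t) (Tp t)) →
      -- these extensions form a strongly continuous semigroup
      IsStronglyContinuousSemigroup Tp ∧
      -- they and their ergodic averages have unique tensor product extensions to `L^p(X, B)`
      (∀ t, ∃! R : Lp B p μ →L[ℂ] Lp B p μ, IsTensorExtension (Tp t) R) ∧
      (∀ t, 0 < t →
        ∃! R : Lp B p μ →L[ℂ] Lp B p μ, IsTensorExtension (ergodicAverage Tp t) R) ∧
      ∀ TB AB : ℝ≥0 → Lp B p μ →L[ℂ] Lp B p μ,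
        (∀ t, IsTensorExtension (Tp t) (TB t)) →
        (∀ t, 0 < t → IsTensorExtension (ergodicAverage Tp t) (AB t)) →
          IsStronglyContinuousSemigroup TB ∧
          (∀ t, 0 < t → ∀ F : Lp B p μ, AB t F = ergodicAverage TB t F) ∧
          -- the maximal function, which is also the supremum over the positive rationals,
          -- exists and satisfies the norm inequality
          ∀ F : Lp B p μ, ∃ M : X → ℝ≥0∞,
            IsAESup μ (fun (t : Set.Ioi (0 : ℝ≥0)) (x : X) => ‖AB t F x‖ₑ) M ∧
            M =ᵐ[μ] (fun x => ⨆ (q : ℚ≥0) (_ : 0 < q), ‖AB (q : ℝ≥0) F x‖ₑ) ∧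
            eLpNorm M p μ ≤
              ENNReal.ofReal (2 * (p.toReal / (p.toReal - 1)) ^ (1 / p.toReal)) *
                eLpNorm F p μ := by
  refine ⟨fun t => ?_, fun Tp hTp => ?_⟩
  · obtain ⟨S, hS, -⟩ := exists_isLpExtension hp'.ne (hc t p hp.le)
    exact ⟨S, hS, fun S' hS' => hS'.unique hp'.ne hS⟩
  have hC := maximalConst_nonneg hp hp'
  have hsg := isStronglyContinuousSemigroup_of_isLpExtension hp hp' hT hc hTp
  have hex : ∀ t, ∃ R : Lp B p μ →L[ℂ] Lp B p μ, IsTensorExtension (Tp t) R := fun t =>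
    (exists_isTensorExtension hp'.ne (Tp t) (by positivity)
      (norm_tensorSum_le hp hp' (hc t) (hTp t))).imp fun R h => h.1
  -- The time average of the extended semigroup is bounded and extends the scalar average; by
  -- uniqueness it is the only such extension, which later identifies `AB t`.
  have hav : ∀ TB : ℝ≥0 → Lp B p μ →L[ℂ] Lp B p μ, (∀ t, IsTensorExtension (Tp t) (TB t)) →
      ∀ t, ∃ A : Lp B p μ →L[ℂ] Lp B p μ, (∀ F, A F = ergodicAverage TB t F) ∧
        IsTensorExtension (ergodicAverage Tp t) A := by
    intro TB hTB t
    obtain ⟨A, hA⟩ := (isStronglyContinuousSemigroup_of_isTensorExtension hp hp' hc hTp hsg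
      hTB).exists_ergodicAverage_eq (norm_tensorExtension_le hp hp' hc hTp hTB) t
    refine ⟨A, hA, isTensorExtension_iff.2 fun f u => ?_⟩
    rw [hA, ergodicAverage_lpTensor hsg hTB]
  refine ⟨hsg, fun t => ?_, fun t _ => ?_, fun TB AB hTB hAB => ?_⟩
  · obtain ⟨R, hR⟩ := hex t
    exact ⟨R, hR, fun R' hR' => hR'.unique hp'.ne hR⟩
  · choose TB hTB using hex
    obtain ⟨A, -, hA⟩ := hav TB hTB t
    exact ⟨A, hA, fun R' hR' => hR'.unique hp'.ne hA⟩
  have hsgB := isStronglyContinuousSemigroup_of_isTensorExtension hp hp' hc hTp hsg hTB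
  have hABeq : ∀ t, 0 < t → ∀ F : Lp B p μ, AB t F = ergodicAverage TB t F := by
    intro t ht F
    obtain ⟨A, hA, hA'⟩ := hav TB hTB t
    rw [(hAB t ht).unique hp'.ne hA', hA]
  refine ⟨hsgB, hABeq, fun F => ⟨_, ?_, EventuallyEq.rfl, ?_⟩⟩
  · refine isAESup_iSup_rat (A := fun t => AB t F) fun t ht => ?_
    refine (hsgB.continuousAt_ergodicAverage F ht).congr ?_
    filter_upwards [lt_mem_nhds ht] with s hs
    exact (hABeq s hs F).symm
  · simp_rw [iSup_subtype']
    refine eLpNorm_iSup_le_of_finset hp hp'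
      (fun q => (Lp.aestronglyMeasurable _).enorm) fun s => ?_
    have hq : ∀ q : {q : ℚ≥0 // 0 < q}, AB (q.1 : ℝ≥0) F = ergodicAverage TB (q.1 : ℝ≥0) F :=
      fun q => hABeq _ (by exact_mod_cast q.2) F
    simp_rw [hq]
    exact eLpNorm_sup_ergodicAverage_le hp hp' hc hTp hTB hsgB F s
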